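/- Let $M$ be a closed $3$-manifold with $H_1(M;\mathbb{Z}/2\mathbb{Z})=0$, and let $T$ be a $1$-vertex generalized triangulation of $M$: finitely many tetrahedra whose triangular faces are identified in pairs by affine gluing maps, such that the quotient space is homeomorphic to $M$ and all vertices of the tetrahedra are identified to a single point. Let $E$ be the set of edges of $T$ (after gluing). For an integer $r\ge 3$, let $\mathrm{Adm}(T,r)$ be the set of maps $\theta\colon E\to\{0,\tfrac12,1,\dots,\tfrac{r-2}{2}\}$ such that for every triangle of $T$, with bounding edges $e_1,e_2,e_3$ (repeated if they are identified), $\theta(e_1)+\theta(e_2)+\theta(e_3)\in\mathbb{Z}$, $\theta(e_i)\le\theta(e_j)+\theta(e_k)$ for $\{i,j,k\}=\{1,2,3\}$, and $\theta(e_1)+\theta(e_2)+\theta(e_3)\le r-2$. Let the admissibility polytope $P_T\subset\mathbb{R}^E$ be the set of all $x$ such that $0\le x(e)\le\tfrac12$ for every edge $e$ and, for every triangle with bounding edges $e_1,e_2,e_3$, $x(e_i)\le x(e_j)+x(e_k)$ for $\{i,j,k\}=\{1,2,3\}$ and $x(e_1)+x(e_2)+x(e_3)\le 1$. Then for every $r\ge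 3$ the admissible colourings in $\mathrm{Adm}(T,r)$ are in bijection with the lattice points $(r-2)P_T\cap\mathbb{Z}^E$, by the map that sends a colouring to the vector of its colours. Consequently, there is a quasi-polynomial $L(P_T,\cdot)\colon\mathbb{N}\to\mathbb{R}$, i.e. a function of the form $L(P_T,k)=\sum_{i=0}^{d}c_i(k)\,k^i$ with periodic coefficients $c_i\colon\mathbb{N}\to\mathbb{R}$ (the Ehrhart quasi-polynomial of $P_T$), such that $L(P_T,k)=\#(kP_T\cap\mathbb{Z}^E)$ for all $k\in\mathbb{N}$, and $\#\mathrm{Adm}(T,r)=L(P_T,r-2)$ for all $r\ge 3$. -/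

import Mathlib

universe u

open scoped Pointwise

/-- A closed generalized triangulation with `n` tetrahedra, as combinatorial gluing data.
Tetrahedra are indexed by `Fin n`, the vertices of each tetrahedron by `Fin 4`, and face `i` of a
tetrahedron is the triangle opposite to its vertex `i`.  Face `i` of `t` is glued to face
`perm t i i` of `adj t i`, by the affine map that sends each vertex `j ≠ i` to `perm t i j`. -/
structure GenTriangulation (n : ℕ) where
  adj : Fin n → Fin 4 → Fin n
  perm : Fin n → Fin 4 → Equiv.Perm (Fin 4)
  /-- The gluing of the partner face leads back to `t` ... -/
  adj_adj : ∀ t i, adj (adj t i) (perm t i i) = t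
  /-- ... by the inverse gluing map, so faces are matched by an involution ... -/
  perm_adj : ∀ t i, perm (adj t i) (perm t i i) = (perm t i)⁻¹
  /-- ... which never matches a face with itself. -/
  ne_self : ∀ t i, (adj t i, perm t i i) ≠ (t, i)

namespace GenTriangulation

variable {n : ℕ} (T : GenTriangulation n)

/-- One elementary identification of points: a point of face `i` of a tetrahedron (barycentric
coordinate `i` vanishes) is identified with its image under the gluing map of that face. -/
def PointRel (p q : Fin n × stdSimplex ℝ (Fin 4)) : Prop :=
  ∃ i : Fin 4, p.2.1 i = 0 ∧ q.1 = T.adj p.1 i ∧ ∀ j : Fin 4, q.2.1 (T.perm p.1 i j) = p.2.1 j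

/-- The underlying topological space: the disjoint union of the tetrahedra modulo the equivalence
relation generated by the gluings, with the quotient topology. -/
def Realization : Type := Quot T.PointRel

instance : TopologicalSpace T.Realization :=
  inferInstanceAs (TopologicalSpace (Quot T.PointRel))

/-- The `k`-faces of the individual tetrahedra, each given by its `k + 1` vertices. -/
abbrev LocalFace (n k : ℕ) : Type := Fin n × {s : Finset (Fin 4) // s.card = k + 1}

/-- One elementary identification of `k`-faces: a face that avoids vertex `i`, hence lies in
the triangle `i`, is identified with its image under the gluing map of that triangle. -/
def FaceRel (k : ℕ) (p q : LocalFace n k) : Prop :=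
  ∃ i : Fin 4, i ∉ p.2.1 ∧ q.1 = T.adj p.1 i ∧
    q.2.1 = p.2.1.map (T.perm p.1 i).toEmbedding

/-- The `k`-faces of the triangulation, after gluing. -/
def Face (k : ℕ) : Type := Quot (T.FaceRel k)

/-- The vertices of the triangulation. -/
abbrev Vertex : Type := T.Face 0

/-- The edges of the triangulation. -/
abbrev Edge : Type := T.Face 1

/-- The edge of the triangulation that is the class of the edge `ab` of the tetrahedron `t`. -/
def edge (t : Fin n) (a b : Fin 4) (h : a ≠ b) : T.Edge :=
  Quot.mk _ (t, ⟨{a, b}, Finset.card_pair h⟩)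

/-- A `1`-vertex triangulation: after gluing, there is exactly one vertex. -/
def IsOneVertex : Prop := Nat.card T.Vertex = 1

/-- `e₁, e₂, e₃` are the edges that bound some triangle of the triangulation, in some order and
with repetition when edges of the triangle are identified. -/
def BoundsTriangle (e₁ e₂ e₃ : T.Edge) : Prop :=
  ∃ (t : Fin n) (a b c : Fin 4) (hab : a ≠ b) (hac : a ≠ c) (hbc : b ≠ c),
    e₁ = T.edge t a b hab ∧ e₂ = T.edge t a c hac ∧ e₃ = T.edge t b c hbc

/-- `Adm(T, r)`: the admissible colourings of the edges by `{0, 1/2, 1, …, (r - 2)/2}`. -/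
def Adm (r : ℕ) : Set (T.Edge → ℝ) :=
  {θ | (∀ e, ∃ m : ℕ, m + 2 ≤ r ∧ θ e = (m : ℝ) / 2) ∧
    ∀ e₁ e₂ e₃, T.BoundsTriangle e₁ e₂ e₃ →
      (∃ z : ℤ, θ e₁ + θ e₂ + θ e₃ = (z : ℝ)) ∧
      (θ e₁ ≤ θ e₂ + θ e₃ ∧ θ e₂ ≤ θ e₁ + θ e₃ ∧ θ e₃ ≤ θ e₁ + θ e₂) ∧
      θ e₁ + θ e₂ + θ e₃ ≤ (r : ℝ) - 2}

/-- The admissibility polytope `P_T`. -/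
def admissibilityPolytope : Set (T.Edge → ℝ) :=
  {x | (∀ e, 0 ≤ x e ∧ x e ≤ 1 / 2) ∧
    ∀ e₁ e₂ e₃, T.BoundsTriangle e₁ e₂ e₃ →
      (x e₁ ≤ x e₂ + x e₃ ∧ x e₂ ≤ x e₁ + x e₃ ∧ x e₃ ≤ x e₁ + x e₂) ∧
      x e₁ + x e₂ + x e₃ ≤ 1}

end GenTriangulation

/-- The lattice points of the dilate `k P` of a set `P` in the real space with coordinates `ι`. -/
def dilateLatticePoints {ι : Type*} (P : Set (ι → ℝ)) (k : ℕ) : Set (ι → ℤ) :=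
  {z | (fun i => (z i : ℝ)) ∈ (k : ℝ) • P}

/-- `L` is a quasi-polynomial: a polynomial expression whose coefficients are periodic. -/
def IsQuasiPolynomial (L : ℕ → ℝ) : Prop :=
  ∃ (d : ℕ) (c : ℕ → ℕ → ℝ), (∀ i, ∃ p : ℕ, 0 < p ∧ Function.Periodic (c i) p) ∧
    ∀ k : ℕ, L k = ∑ i ∈ Finset.range (d + 1), (k : ℝ) ^ i * c i k

/-- `L` is the Ehrhart quasi-polynomial `L(P, ·)` of `P`: a quasi-polynomial that counts, for
every `k`, the lattice points of `k P`. -/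
def IsEhrhartQuasiPolynomial {ι : Type*} (P : Set (ι → ℝ)) (L : ℕ → ℝ) : Prop :=
  IsQuasiPolynomial L ∧
    ∀ k : ℕ, (dilateLatticePoints P k).Finite ∧ ((dilateLatticePoints P k).ncard : ℝ) = L k

/-- The singular homology group `H₁(M; ℤ/2ℤ)` vanishes. -/
def TrivialFirstHomologyModTwo (M : Type u) [TopologicalSpace M] : Prop :=
  CategoryTheory.Limits.IsZero
    (((AlgebraicTopology.singularHomologyFunctor (ModuleCat.{u} (ZMod 2)) 1).obj
      (ModuleCat.of (ZMod 2) (ULift.{u} (ZMod 2)))).obj (TopCat.of M))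

/-! Double an admissible colouring and reduce modulo two. The integrality of the sums over triangles
says that the result is a cocycle `φ` on the edges, and the colours are integers exactly when `φ =
0`. For integral colourings the conditions defining `Adm(T, r)` and `(r - 2) P_T` agree
(`mem_Adm_intCast_iff`). So the bijection rests on `cocycle_eq_zero`.

To show `φ = 0`, write `φ` on each tetrahedron as the coboundary of vertex signs `χ`. A gluing
changes `χ` by a sign `g` of the face (`exists_isSignCocycle`). These data describe a real line
bundle with transition signs `g`. A `TwistedSign` is a compatible choice of signs on faces, and
weighting these signs by monomials in barycentric coordinates gives a section. All these sections
together form `signVector`, which is well defined up to sign on the quotient. Where it does not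
vanish, it can be lifted through the double cover of nonzero vectors by vectors up to sign.
Vanishing first homology modulo two forces lifts along closed paths to close up (`lift_closed`). In
a one-vertex triangulation every edge is such a path, and the coordinate `TwistedSign.vertex` has
the values `χ` at its ends. Hence `χ` is constant on each tetrahedron and `φ` vanishes.

It remains to see that `signVector` has no zeros. By `signVector_eq_zero` only midpoints of edges
are in question, where an edge could be glued to itself with the wrong sign. The manifold structure
excludes this. A punctured Euclidean neighbourhood of dimension at least three is simply connected,
so the vector lifts there, and comparison with the lift yields a nonzero twisted sign on that edge
(`exists_twistedSign_ne_zero`).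

The quasi-polynomial comes from an elementary proof of Ehrhart's theorem by induction over faces.
For a polytope containing the origin, passing from one dilate to the next adds, after rescaling,
only points on faces away from the origin (`isResiduePolynomial_of_nonneg`). A general rational face
is first translated so that it contains the origin (`exists_isResiduePolynomial`). -/

open Topology Polynomial

/-! ### Maps to a real vector space up to sign -/

/-- Real vectors with coordinates `ι`, up to sign. -/
abbrev UpToSign (ι : Type*) : Type _ := Quotient (MulAction.orbitRel ℤˣ (ι → ℝ))

namespace UpToSign

variable {ι : Type*}

/-- The class of a vector up to sign. -/
abbrev mk (v : ι → ℝ) : UpToSign ι := Quotient.mk _ v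

theorem mk_eq_mk {v w : ι → ℝ} : mk v = mk w ↔ v = w ∨ v = -w := by
  rw [mk, mk, Quotient.eq, MulAction.orbitRel_apply, MulAction.mem_orbit_iff]
  constructor
  · rintro ⟨g, rfl⟩
    rcases Int.units_eq_one_or g with rfl | rfl <;> simp [Units.smul_def]
  · rintro (rfl | rfl)
    · exact ⟨1, by simp⟩
    · exact ⟨-1, by simp [Units.smul_def]⟩

theorem mk_eq_mk_zero {v : ι → ℝ} : mk v = mk 0 ↔ v = 0 := by
  simp [mk_eq_mk]

theorem mk_neg (v : ι → ℝ) : mk (-v) = mk v := mk_eq_mk.2 (Or.inr rfl)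

theorem continuous_mk : Continuous (mk : (ι → ℝ) → UpToSign ι) := continuous_quotient_mk'

instance : ContinuousConstSMul ℤˣ (ι → ℝ) where
  continuous_const_smul g := by
    rcases Int.units_eq_one_or g with rfl | rfl
    · simpa using continuous_id'
    · simpa [Units.smul_def] using continuous_neg

/-- The group of signs is finite and acts with trivial stabilizers away from the zero vector. -/
theorem isCoveringMapOn_mk [Finite ι] :
    IsCoveringMapOn (mk : (ι → ℝ) → UpToSign ι) {x | x ≠ mk 0} := by
  have h := isCoveringMapOn_quotientMk_of_properlyDiscontinuousSMul (G := ℤˣ) (E := ι → ℝ)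
  refine h.mono ?_
  intro x hx
  induction x using Quotient.inductionOn with | _ v => ?_
  refine ⟨v, ?_, rfl⟩
  simp only [Set.mem_ofPred_eq]
  rw [eq_bot_iff]
  intro g hg
  rw [MulAction.mem_stabilizer_iff] at hg
  rcases Int.units_eq_one_or g with rfl | rfl
  · simp
  · exfalso
    simp only [Units.smul_def, Units.val_neg, Units.val_one, neg_smul, one_smul] at hg
    exact hx (mk_eq_mk_zero.2 (self_eq_neg.1 hg.symm))

/-- The locus `w = w'` is closed, and so is its complement, the locus `w = -w'`. The two are
disjoint because the vectors do not vanish. -/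
theorem eqOn_of_mk_eq {A : Type*} [TopologicalSpace A] {s : Set A} (hs : IsPreconnected s)
    {w w' : A → ι → ℝ} (hw : ContinuousOn w s) (hw' : ContinuousOn w' s)
    (h : ∀ a ∈ s, mk (w a) = mk (w' a)) (h0 : ∀ a ∈ s, w a ≠ 0) {a : A} (ha : a ∈ s)
    (haa : w a = w' a) : Set.EqOn w w' s := by
  have : PreconnectedSpace s := Subtype.preconnectedSpace hs
  rw [continuousOn_iff_continuous_domRestrict] at hw hw'
  have hc : IsClopen {x : s | s.domRestrict w x = s.domRestrict w' x} := by
    refine ⟨isClosed_eq hw hw', ?_⟩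
    have : {x : s | s.domRestrict w x = s.domRestrict w' x} =
        {x : s | s.domRestrict w x = -s.domRestrict w' x}ᶜ := by
      ext ⟨x, hx⟩
      change w x = w' x ↔ ¬ w x = -w' x
      rcases mk_eq_mk.1 (h x hx) with h1 | h1
      · simp only [h1, true_iff]
        intro h2
        exact h0 x hx (by rw [h1]; exact self_eq_neg.1 h2)
      · simp only [h1, not_true, iff_false]
        intro h2
        exact h0 x hx (by rw [h1, neg_eq_zero]; exact self_eq_neg.1 h2.symm)
    rw [this]
    exact (isClosed_eq hw hw'.neg).isOpen_compl
  have := hc.eq_univ ⟨⟨a, ha⟩, haa⟩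
  intro x hx
  have h2 : (⟨x, hx⟩ : s) ∈ {x : s | s.domRestrict w x = s.domRestrict w' x} := by rw [this]; trivial
  exact h2

theorem eq_of_mk_eq {A : Type*} [TopologicalSpace A] [PreconnectedSpace A]
    {w w' : A → ι → ℝ} (hw : Continuous w) (hw' : Continuous w')
    (h : ∀ a, mk (w a) = mk (w' a)) (h0 : ∀ a, w a ≠ 0) {a : A}
    (haa : w a = w' a) : w = w' :=
  Set.eqOn_univ _ _ |>.1 (eqOn_of_mk_eq isPreconnected_univ hw.continuousOn hw'.continuousOn
    (fun a _ => h a) (fun a _ => h0 a) (Set.mem_univ a) haa)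

theorem exists_lift [Finite ι] {A : Type*} [TopologicalSpace A] [SimplyConnectedSpace A]
    [LocallyPathConnectedSpace A] {F : A → UpToSign ι} (hF : Continuous F)
    (h0 : ∀ a, F a ≠ mk 0) (a : A) {v : ι → ℝ} (hv : mk v = F a) :
    ∃ w : A → ι → ℝ, Continuous w ∧ (∀ x, mk (w x) = F x) ∧ w a = v := by
  obtain ⟨w, ⟨h1, h2⟩, -⟩ := isCoveringMapOn_mk.existsUnique_continuousMap_lifts
    ⟨F, hF⟩ (a₀ := a) (e₀ := v) hv h0
  exact ⟨w, w.continuous, fun x => congrFun h2 x, h1⟩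

theorem exists_liftOn_of_starConvex [Finite ι] {E : Type*} [NormedAddCommGroup E]
    [NormedSpace ℝ E] {s : Set E} (hs : IsOpen s) {a : E} (ha : a ∈ s) (hsa : StarConvex ℝ a s)
    {F : E → UpToSign ι} (hF : ContinuousOn F s) (h0 : ∀ x ∈ s, F x ≠ mk 0)
    {v : ι → ℝ} (hv : mk v = F a) :
    ∃ w : E → ι → ℝ, ContinuousOn w s ∧ (∀ x ∈ s, mk (w x) = F x) ∧ w a = v := by
  classical
  have := hsa.contractibleSpace ⟨a, ha⟩
  have := hs.locallyPathConnectedSpace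
  rw [continuousOn_iff_continuous_domRestrict] at hF
  obtain ⟨w, h1, h2, h3⟩ := exists_lift hF (fun x => h0 x x.2) ⟨a, ha⟩ hv
  refine ⟨fun x => if h : x ∈ s then w ⟨x, h⟩ else 0, ?_, ?_, ?_⟩
  · rw [continuousOn_iff_continuous_domRestrict]
    convert h1 using 1
    ext x
    simp
  · intro x hx
    simp [hx, h2]
  · simp [ha, h3]

/-- A nowhere zero map up to sign on a punctured space of dimension at least three lifts. -/
theorem exists_lift_compl_zero [Finite ι] {E : Type*} [NormedAddCommGroup E]
    [NormedSpace ℝ E] (hE : 2 < Module.rank ℝ E)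
    {F : E → UpToSign ι} (hF : ContinuousOn F {0}ᶜ) (h0 : ∀ x, x ≠ 0 → F x ≠ mk 0) :
    ∃ w : E → ι → ℝ, ContinuousOn w {0}ᶜ ∧ ∀ x, x ≠ 0 → mk (w x) = F x := by
  classical
  have hnt : Nontrivial E := rank_pos_iff_nontrivial.1 (lt_trans two_pos hE)
  obtain ⟨e, he⟩ := exists_ne (0 : E)
  obtain ⟨φ, hφ⟩ : ∃ φ : E →L[ℝ] ℝ, φ e = 1 := by
    obtain ⟨φ, hφ⟩ := SeparatingDual.exists_ne_zero (R := ℝ) he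
    exact ⟨(φ e)⁻¹ • φ, by simp [hφ]⟩
  -- The set is the complement of the closed ray from the origin opposite to `ε • e`. The sets for
  -- `ε = 1` and `ε = -1` cover the punctured space. They meet in the complement of a line, which is
  -- connected because the dimension exceeds two, so lifts on the two sets can be matched and glued.
  have hstar : ∀ ε : ℝ, ε ≠ 0 →
      StarConvex ℝ (ε • e) {x : E | 0 < ε * φ x ∨ x - φ x • e ≠ 0} := by
    intro ε hε x hx a b ha hb hab
    have hε2 : 0 < ε * ε := mul_self_pos.2 hε
    have h1 : φ (a • ε • e + b • x) = a * ε + b * φ x := by simp [hφ]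
    have h2 : a • ε • e + b • x - φ (a • ε • e + b • x) • e = b • (x - φ x • e) := by
      rw [h1]; module
    change 0 < ε * φ (a • ε • e + b • x) ∨ a • ε • e + b • x - φ (a • ε • e + b • x) • e ≠ 0
    rw [h2, h1]
    rcases eq_or_lt_of_le hb with rfl | hb
    · left
      have : a = 1 := by linarith
      subst this
      linarith
    · rcases hx with hx | hx
      · left
        have : ε * (a * ε + b * φ x) = a * (ε * ε) + b * (ε * φ x) := by ring
        rw [this]
        positivity
      · right
        exact smul_ne_zero hb.ne' hx
  have hopen : ∀ ε : ℝ, IsOpen {x : E | 0 < ε * φ x ∨ x - φ x • e ≠ 0} := by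
    intro ε
    have h1 : IsOpen {x : E | 0 < ε * φ x} := isOpen_lt continuous_const (by fun_prop)
    have h2 : IsOpen {x : E | x - φ x • e ≠ 0} := isOpen_ne_fun (by fun_prop) continuous_const
    exact h1.union h2
  have hsub : ∀ ε : ℝ, {x : E | 0 < ε * φ x ∨ x - φ x • e ≠ 0} ⊆ {0}ᶜ := by
    rintro ε x hx rfl
    simp at hx
  have hlift : ∀ ε : ℝ, ε ≠ 0 → ∀ f ∈ {x : E | 0 < ε * φ x ∨ x - φ x • e ≠ 0},
      ∀ v : ι → ℝ, mk v = F f → ∃ w : E → ι → ℝ,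
        ContinuousOn w {x : E | 0 < ε * φ x ∨ x - φ x • e ≠ 0} ∧
        (∀ x ∈ {x : E | 0 < ε * φ x ∨ x - φ x • e ≠ 0}, mk (w x) = F x) ∧ w f = v := by
    intro ε hε f hf v hv
    obtain ⟨u, hu⟩ := Quotient.exists_rep (F (ε • e))
    obtain ⟨w, h1, h2, -⟩ := exists_liftOn_of_starConvex (hopen ε)
      (a := ε • e) (Or.inl (by simpa [hφ] using mul_self_pos.2 hε)) (hstar ε hε)
      (hF.mono (hsub ε)) (fun x hx => h0 x (hsub ε hx)) hu
    rcases mk_eq_mk.1 ((h2 f hf).trans hv.symm) with h3 | h3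
    · exact ⟨w, h1, h2, h3⟩
    · exact ⟨-w, h1.neg, fun x hx => (mk_neg _).trans (h2 x hx), by simp [h3]⟩
  have hconn : IsConnected {x : E | x - φ x • e ≠ 0} := by
    have := (isPathConnected_compl_of_one_lt_codim (F := E) (E := ℝ ∙ e) (by
      by_contra! hle
      have h1 := Submodule.rank_quotient_add_rank (ℝ ∙ e)
      have h2 : Module.rank ℝ (ℝ ∙ e) ≤ 1 := by
        simpa using rank_span_le (R := ℝ) ({e} : Set E)
      have h3 : Module.rank ℝ E ≤ 1 + 1 := by rw [← h1]; exact add_le_add hle h2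
      rw [one_add_one_eq_two] at h3
      exact absurd hE (not_lt.2 h3))).isConnected
    convert this using 1
    ext x
    simp only [Set.mem_compl_iff, SetLike.mem_coe, Submodule.mem_span_singleton]
    change ¬ _ ↔ _
    rw [not_iff_not, sub_eq_zero]
    refine ⟨fun h => ⟨_, h.symm⟩, ?_⟩
    rintro ⟨c, rfl⟩
    simp [hφ]
  obtain ⟨f, hf⟩ := hconn.nonempty
  obtain ⟨v, hv⟩ := Quotient.exists_rep (F f)
  obtain ⟨w₁, hc₁, hm₁, hf₁⟩ := hlift 1 one_ne_zero f (Or.inr hf) v hv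
  obtain ⟨w₂, hc₂, hm₂, hf₂⟩ := hlift (-1) (by norm_num) f (Or.inr hf) v hv
  have heq : Set.EqOn w₁ w₂ {x : E | x - φ x • e ≠ 0} :=
    eqOn_of_mk_eq hconn.isPreconnected (hc₁.mono fun x hx => Or.inr hx)
      (hc₂.mono fun x hx => Or.inr hx)
      (fun x hx => (hm₁ x (Or.inr hx)).trans (hm₂ x (Or.inr hx)).symm)
      (fun x hx h => h0 x (hsub 1 (Or.inr hx)) (by rw [← hm₁ x (Or.inr hx), h])) hf
      (hf₁.trans hf₂.symm)
  have hcover : ∀ x : E, x ≠ 0 → x ∈ {x : E | 0 < 1 * φ x ∨ x - φ x • e ≠ 0} ∨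
      x ∈ {x : E | 0 < -1 * φ x ∨ x - φ x • e ≠ 0} := by
    intro x hx
    rcases lt_trichotomy (φ x) 0 with h | h | h
    · exact Or.inr (Or.inl (by linarith))
    · exact Or.inl (Or.inr (by simpa [h] using hx))
    · exact Or.inl (Or.inl (by linarith))
  let w : E → ι → ℝ := fun x =>
    if x ∈ {x : E | 0 < 1 * φ x ∨ x - φ x • e ≠ 0} then w₁ x else w₂ x
  have hw₁ : Set.EqOn w w₁ {x : E | 0 < 1 * φ x ∨ x - φ x • e ≠ 0} := fun x hx => if_pos hx
  have hw₂ : Set.EqOn w w₂ {x : E | 0 < -1 * φ x ∨ x - φ x • e ≠ 0} := by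
    intro x hx
    by_cases h : x ∈ {x : E | 0 < 1 * φ x ∨ x - φ x • e ≠ 0}
    · rw [hw₁ h]
      apply heq
      rcases hx with hx | hx
      · rcases h with h | h
        · linarith
        · exact h
      · exact hx
    · exact if_neg h
  refine ⟨w, fun x hx => ContinuousAt.continuousWithinAt ?_, fun x hx => ?_⟩
  · rcases hcover x hx with h | h
    · exact ((hc₁.congr hw₁).continuousAt ((hopen 1).mem_nhds h))
    · exact ((hc₂.congr hw₂).continuousAt ((hopen (-1)).mem_nhds h))
  · rcases hcover x hx with h | h
    · rw [hw₁ h, hm₁ x h]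
    · rw [hw₂ h, hm₂ x h]

end UpToSign

/-! ### Loops and first homology modulo two -/

section Homology

open CategoryTheory AlgebraicTopology Simplicial

instance (n : ℕ) : LocallyPathConnectedSpace (stdSimplex ℝ (Fin (n + 1))) :=
  (convex_stdSimplex ℝ _).locallyPathConnectedSpace

instance (n : ℕ) : ContractibleSpace (stdSimplex ℝ (Fin (n + 1))) :=
  (convex_stdSimplex ℝ _).contractibleSpace ⟨_, (stdSimplex.vertex 0).2⟩

/-- The continuous map of standard simplices that includes the face opposite to vertex `i`. -/
noncomputable def stdSimplexFace (n : ℕ) (i : Fin (n + 2)) :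
    C(stdSimplex ℝ (Fin (n + 1)), stdSimplex ℝ (Fin (n + 2))) :=
  ⟨stdSimplex.map i.succAbove, stdSimplex.continuous_map _⟩

theorem neg_one_pow_zsmul_zmod_two (k : ℕ) (y : ZMod 2) : (-1 : ℤ) ^ k • y = y := by
  rcases neg_one_pow_eq_or ℤ k with h | h <;> simp [h, ZMod.neg_eq_self_mod_two]

/-- An additive function on paths that vanishes on boundaries of triangles vanishes on loops
when the first homology vanishes. -/
theorem TrivialFirstHomologyModTwo.apply_eq_zero {M : Type u} [TopologicalSpace M]
    (hM : TrivialFirstHomologyModTwo M) (f : C(stdSimplex ℝ (Fin 2), M) → ZMod 2)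
    (hf : ∀ τ : C(stdSimplex ℝ (Fin 3), M), ∑ i, f (τ.comp (stdSimplexFace 1 i)) = 0)
    (γ : C(stdSimplex ℝ (Fin 2), M))
    (hγ : γ.comp (stdSimplexFace 0 0) = γ.comp (stdSimplexFace 0 1)) : f γ = 0 := by
  let R : ModuleCat.{u} (ZMod 2) := ModuleCat.of (ZMod 2) (ULift.{u} (ZMod 2))
  let X : SSet.{u} := TopCat.toSSet.obj (TopCat.of M)
  let K := X.chainComplex R
  let e1 : X _⦋1⦌ ≃ C(stdSimplex ℝ (Fin 2), M) := (TopCat.of M).toSSetObjEquiv _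
  let e2 : X _⦋2⦌ ≃ C(stdSimplex ℝ (Fin 3), M) := (TopCat.of M).toSSetObjEquiv _
  let e0 : X _⦋0⦌ ≃ C(stdSimplex ℝ (Fin 1), M) := (TopCat.of M).toSSetObjEquiv _
  have hK : Limits.IsZero (K.homology 1) := hM
  -- The linear extension of `f` to singular chains; `hf` makes it a cocycle.
  let φ : K.X 1 ⟶ R := (X.isColimitChainComplexXCofan R 1).desc
    (Limits.Cofan.mk R fun x => f (e1 x) • 𝟙 R)
  have hφ (x : X _⦋1⦌) : X.ιChainComplex x ≫ φ = f (e1 x) • 𝟙 R :=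
    (X.isColimitChainComplexXCofan R 1).fac _ ⟨x⟩
  have hdφ : K.d 2 1 ≫ φ = 0 := by
    apply SSet.chainComplex_hom_ext
    intro x
    rw [SSet.ιChainComplex_d_assoc, Preadditive.sum_comp, Limits.comp_zero]
    trans (∑ i, f ((e2 x).comp (stdSimplexFace 1 i))) • 𝟙 R
    · rw [Finset.sum_smul]
      refine Finset.sum_congr rfl fun i _ => ?_
      rw [Preadditive.zsmul_comp, hφ, ← smul_assoc, neg_one_pow_zsmul_zmod_two]
      rfl
    · rw [hf, zero_smul]
  let z : R ⟶ K.X 1 := X.ιChainComplex (e1.symm γ)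
  have hz : z ≫ K.d 1 0 = 0 := by
    have h0 : X.δ 0 (e1.symm γ) = X.δ 1 (e1.symm γ) := by
      apply e0.injective
      change (e1 (e1.symm γ)).comp (stdSimplexFace 0 0) = (e1 (e1.symm γ)).comp (stdSimplexFace 0 1)
      rw [Equiv.apply_symm_apply, hγ]
    rw [SSet.ιChainComplex_d]
    simp [Fin.sum_univ_two, h0]
  -- The pairing of the cycle `γ` with the cocycle factors through the zero object `H₁`.
  have h1 : K.liftCycles z 0 (by simp) hz ≫ K.homologyπ 1 ≫ K.homologyι 1 ≫
      K.descOpcycles φ 2 (by simp) hdφ = 0 := by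
    rw [hK.eq_of_tgt (K.homologyπ 1) 0]
    simp
  have h2 : z ≫ φ = 0 := by
    rw [← h1]
    simp
  rw [hφ, Equiv.apply_symm_apply] at h2
  have h3 := congrArg (fun g => (g.hom (ULift.up 1)).down) h2
  change f γ • (1 : ZMod 2) = 0 at h3
  simpa using h3

end Homology

/-! ### Lifts along closed paths -/

section Lift

/-- If the first homology modulo two vanishes, then the lift of a nowhere zero map up to sign
along a closed path is closed. -/
theorem TrivialFirstHomologyModTwo.lift_closed {M : Type u} [TopologicalSpace M]
    (hM : TrivialFirstHomologyModTwo M) {ι : Type*} [Finite ι] {F : M → UpToSign ι}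
    (hF : Continuous F) (h0 : ∀ x, F x ≠ UpToSign.mk 0) (γ : C(stdSimplex ℝ (Fin 2), M))
    (hγ : γ (stdSimplex.vertex 0) = γ (stdSimplex.vertex 1))
    {w : stdSimplex ℝ (Fin 2) → ι → ℝ} (hw : Continuous w)
    (hwF : ∀ x, UpToSign.mk (w x) = F (γ x)) :
    w (stdSimplex.vertex 0) = w (stdSimplex.vertex 1) := by
  classical
  choose u hu using fun x => Quotient.exists_rep (F x)
  have hu0 (x) : u x ≠ 0 := fun h => h0 x (by rw [← hu x, h])
  have hlift (n : ℕ) (σ : C(stdSimplex ℝ (Fin (n + 1)), M)) :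
      ∃ w : stdSimplex ℝ (Fin (n + 1)) → ι → ℝ, Continuous w ∧
        ∀ x, UpToSign.mk (w x) = F (σ x) := by
    obtain ⟨w, h1, h2, -⟩ := UpToSign.exists_lift (hF.comp σ.continuous) (fun a => h0 _)
      (stdSimplex.vertex 0) (hu (σ (stdSimplex.vertex 0)))
    exact ⟨w, h1, h2⟩
  -- Relative to the chosen representatives `u`, `δ` records the sign of a vector. Then `f σ` tells
  -- whether transport along `σ` matches the representatives at its ends. Negating a lift changes
  -- both summands, so `f` does not depend on the lift.
  let δ : (ι → ℝ) → M → ZMod 2 := fun v x => if v = u x then 0 else 1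
  choose W hWc hW using hlift 1
  let f : C(stdSimplex ℝ (Fin 2), M) → ZMod 2 := fun σ =>
    δ (W σ (stdSimplex.vertex 0)) (σ (stdSimplex.vertex 0)) +
    δ (W σ (stdSimplex.vertex 1)) (σ (stdSimplex.vertex 1))
  have hδ (v : ι → ℝ) (x : M) (hv : UpToSign.mk v = F x) : δ (-v) x = δ v x + 1 := by
    rcases UpToSign.mk_eq_mk.1 (hv.trans (hu x).symm) with h | h
    · have : -u x ≠ u x := fun h' => hu0 x (self_eq_neg.1 h'.symm)
      simp [δ, h, this]
    · have : -u x ≠ u x := fun h' => hu0 x (self_eq_neg.1 h'.symm)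
      simp [δ, h, this]
      decide
  have hf (σ : C(stdSimplex ℝ (Fin 2), M)) (w : stdSimplex ℝ (Fin 2) → ι → ℝ)
      (hw : Continuous w) (hwF : ∀ x, UpToSign.mk (w x) = F (σ x)) :
      f σ = δ (w (stdSimplex.vertex 0)) (σ (stdSimplex.vertex 0)) +
        δ (w (stdSimplex.vertex 1)) (σ (stdSimplex.vertex 1)) := by
    have hne (x) : w x ≠ 0 := fun h => h0 (σ x) (by rw [← hwF x, h])
    rcases UpToSign.mk_eq_mk.1 ((hW σ (stdSimplex.vertex 0)).trans
      (hwF (stdSimplex.vertex 0)).symm) with h | h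
    · have : w = W σ := UpToSign.eq_of_mk_eq hw (hWc σ)
        (fun x => (hwF x).trans (hW σ x).symm) hne h.symm
      rw [this]
    · have : w = fun x => -W σ x := UpToSign.eq_of_mk_eq hw (hWc σ).neg
        (fun x => (hwF x).trans ((hW σ x).symm.trans (UpToSign.mk_neg _).symm)) hne
        (a := stdSimplex.vertex 0) (by rw [h, neg_neg])
      rw [this]
      simp only [f]
      rw [hδ _ _ (hW σ _), hδ _ _ (hW σ _)]
      generalize δ (W σ _) _ = a
      generalize δ (W σ _) _ = b
      revert a b
      decide
  have key : f γ = 0 := by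
    refine hM.apply_eq_zero f (fun τ => ?_) γ ?_
    -- One lift over the whole triangle serves all three sides, so every vertex contributes twice.
    · obtain ⟨w, h1, h2⟩ := hlift 2 τ
      have (i : Fin 3) : f (τ.comp (stdSimplexFace 1 i)) =
          δ (w (stdSimplex.vertex (i.succAbove 0))) (τ (stdSimplex.vertex (i.succAbove 0))) +
          δ (w (stdSimplex.vertex (i.succAbove 1))) (τ (stdSimplex.vertex (i.succAbove 1))) := by
        have := hf (τ.comp (stdSimplexFace 1 i)) (w ∘ stdSimplexFace 1 i)
          (h1.comp (stdSimplexFace 1 i).continuous) (fun x => h2 _)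
        simpa only [stdSimplexFace, Function.comp_apply, ContinuousMap.coe_mk,
          ContinuousMap.comp_apply, stdSimplex.map_vertex] using this
      refine (Finset.sum_congr rfl fun i _ => this i).trans ?_
      rw [Fin.sum_univ_three]
      have e1 : (0 : Fin 3).succAbove (0 : Fin 2) = 1 := rfl
      have e2 : (0 : Fin 3).succAbove (1 : Fin 2) = 2 := rfl
      have e3 : (1 : Fin 3).succAbove (0 : Fin 2) = 0 := rfl
      have e4 : (1 : Fin 3).succAbove (1 : Fin 2) = 2 := rfl
      have e5 : (2 : Fin 3).succAbove (0 : Fin 2) = 0 := rfl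
      have e6 : (2 : Fin 3).succAbove (1 : Fin 2) = 1 := rfl
      rw [e1, e2, e3, e4, e5, e6]
      generalize δ (w (stdSimplex.vertex 0)) _ = a
      generalize δ (w (stdSimplex.vertex 1)) _ = b
      generalize δ (w (stdSimplex.vertex 2)) _ = c
      revert a b c
      decide
    · ext x
      rw [Subsingleton.elim x (stdSimplex.vertex 0)]
      simp only [stdSimplexFace, ContinuousMap.coe_mk, ContinuousMap.comp_apply,
        stdSimplex.map_vertex]
      exact hγ.symm
  rw [hf γ w hw hwF, hγ] at key
  have h1 : UpToSign.mk (w (stdSimplex.vertex 0)) = UpToSign.mk (w (stdSimplex.vertex 1)) := by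
    rw [hwF, hwF, hγ]
  rcases UpToSign.mk_eq_mk.1 h1 with h | h
  · exact h
  · rw [h, hδ _ _ (hwF _)] at key
    generalize δ (w (stdSimplex.vertex 1)) _ = a at key
    have : ∀ a : ZMod 2, a + 1 + a ≠ 0 := by decide
    exact absurd key (this a)

end Lift

/-! ### Signs on triangulations -/

theorem SignType.coe_real_ne_zero {a : SignType} (h : a ≠ 0) : (a : ℝ) ≠ 0 := by
  cases a <;> simp_all

namespace GenTriangulation

variable {n : ℕ} {T : GenTriangulation n}

/-- A nowhere zero sign for each face of each tetrahedron such that some nowhere zero signs of the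
vertices change by the sign of the face along each gluing. -/
structure IsSignCocycle (T : GenTriangulation n) (χ g : Fin n → Fin 4 → SignType) : Prop where
  vertex_ne_zero : ∀ t a, χ t a ≠ 0
  face_ne_zero : ∀ t i, g t i ≠ 0
  vertex_adj : ∀ t i j, j ≠ i → χ (T.adj t i) (T.perm t i j) = g t i * χ t j

/-- Crossing a face and returning fixes the nonzero sign of any vertex on that face. -/
theorem IsSignCocycle.face_mul_adj {χ g : Fin n → Fin 4 → SignType} (h : T.IsSignCocycle χ g)
    (t : Fin n) (i : Fin 4) : g (T.adj t i) (T.perm t i i) * g t i = 1 := by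
  obtain ⟨j, hj⟩ := exists_ne i
  have h1 := h.vertex_adj t i j hj
  have h2 := h.vertex_adj (T.adj t i) (T.perm t i i) (T.perm t i j)
    (fun h => hj ((T.perm t i).injective h))
  rw [T.adj_adj, T.perm_adj, h1] at h2
  simp only [Equiv.Perm.inv_def, Equiv.symm_apply_apply] at h2
  have h3 := h.vertex_ne_zero t j
  revert h2 h3
  generalize g t i = x
  generalize g _ _ = y
  generalize χ t j = z
  revert x y z
  decide

/-- The involution on the faces of the tetrahedra that is given by the gluing. -/
def partner (T : GenTriangulation n) (x : Fin n × Fin 4) : Fin n × Fin 4 :=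
  (T.adj x.1 x.2, T.perm x.1 x.2 x.2)

theorem partner_partner (x : Fin n × Fin 4) : T.partner (T.partner x) = x := by
  refine Prod.ext (T.adj_adj x.1 x.2) ?_
  change T.perm (T.adj x.1 x.2) (T.perm x.1 x.2 x.2) (T.perm x.1 x.2 x.2) = x.2
  rw [T.perm_adj, Equiv.Perm.inv_def, Equiv.symm_apply_apply]

theorem partner_ne (x : Fin n × Fin 4) : T.partner x ≠ x := T.ne_self x.1 x.2

/-- The signs of the faces of the tetrahedra that change by `g` along the gluings. -/
@[ext]
structure TwistedSign (T : GenTriangulation n) (g : Fin n → Fin 4 → SignType) where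
  val : Fin n → Finset (Fin 4) → SignType
  map_adj : ∀ t i s, i ∉ s →
    val (T.adj t i) (s.map (T.perm t i).toEmbedding) = g t i * val t s

instance (g : Fin n → Fin 4 → SignType) : Finite (T.TwistedSign g) :=
  Finite.of_injective TwistedSign.val fun _ _ => TwistedSign.ext

variable {χ g : Fin n → Fin 4 → SignType}

namespace TwistedSign

/-- The part of a twisted sign on the faces with `k` vertices. -/
def ofCard (ε : T.TwistedSign g) (k : ℕ) : T.TwistedSign g where
  val t s := if s.card = k then ε.val t s else 0
  map_adj t i s hi := by
    rw [Finset.card_map]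
    split_ifs
    · exact ε.map_adj t i s hi
    · simp

/-- The twisted sign on vertices of a sign cocycle. -/
def vertex (h : T.IsSignCocycle χ g) : T.TwistedSign g where
  val t s := if s.card = 1 then ∏ j ∈ s, χ t j else 0
  map_adj t i s hi := by
    rw [Finset.card_map]
    split_ifs with hs
    · obtain ⟨a, rfl⟩ := Finset.card_eq_one.1 hs
      simp only [Finset.map_singleton, Equiv.coe_toEmbedding, Finset.prod_singleton]
      exact h.vertex_adj t i a (by rintro rfl; simp at hi)
    · simp

/-- A triangle is identified only with its partner, so the only consistency condition is
`face_mul_adj`. -/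
theorem exists_ne_zero_of_card_eq_three (h : T.IsSignCocycle χ g) (t : Fin n) {s : Finset (Fin 4)}
    (hs : s.card = 3) : ∃ ε : T.TwistedSign g, ε.val t s ≠ 0 := by
  classical
  have hface : ∀ s : Finset (Fin 4), s.card = 3 → ∃ i, s = {i}ᶜ := by decide
  obtain ⟨i, rfl⟩ := hface s hs
  let v : Fin n × Fin 4 → SignType := fun x =>
    if x = (t, i) then 1 else if x = T.partner (t, i) then g t i else 0
  have hv (x : Fin n × Fin 4) : v (T.partner x) = g x.1 x.2 * v x := by
    by_cases h1 : x = (t, i)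
    · subst h1
      simp [v, partner_ne]
    · by_cases h2 : x = T.partner (t, i)
      · subst h2
        simp only [v, partner_partner, if_true, h1, if_false]
        exact (h.face_mul_adj t i).symm
      · have h3 : T.partner x ≠ (t, i) := fun h => h2 (by rw [← h, partner_partner])
        have h4 : T.partner x ≠ T.partner (t, i) := fun h => h1 (by
          rw [← partner_partner (T := T) x, h, partner_partner])
        simp [v, h1, h2, h3, h4]
  refine ⟨⟨fun u s => if s.card = 3 then ∏ k ∈ sᶜ, v (u, k) else 0, ?_⟩, ?_⟩
  · intro u k s' hk
    rw [Finset.card_map]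
    split_ifs with hc
    · obtain ⟨l, rfl⟩ := hface s' hc
      obtain rfl : k = l := by simpa using hk
      have hmap : ({k}ᶜ : Finset (Fin 4)).map (T.perm u k).toEmbedding = {T.perm u k k}ᶜ := by
        ext x
        simp [← Equiv.symm_apply_eq]
      rw [hmap, compl_compl, compl_compl, Finset.prod_singleton, Finset.prod_singleton]
      exact hv (u, k)
    · simp
  · simp [hs, v]

/-- The full tetrahedron avoids no vertex, so no gluing constrains its sign. -/
theorem exists_ne_zero_of_card_eq_four (t : Fin n) {s : Finset (Fin 4)}
    (hs : s.card = 4) : ∃ ε : T.TwistedSign g, ε.val t s ≠ 0 := by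
  classical
  have : s = Finset.univ := Finset.eq_univ_of_card s hs
  subst this
  refine ⟨⟨fun u s => if u = t ∧ s = Finset.univ then 1 else 0, ?_⟩, by simp⟩
  intro u i s hi
  have h1 : s ≠ Finset.univ := by rintro rfl; simp at hi
  have h2 : s.map (T.perm u i).toEmbedding ≠ Finset.univ := by
    intro h
    apply h1
    rw [← Finset.card_eq_iff_eq_univ] at h ⊢
    simpa using h
  simp [h1, h2]

end TwistedSign

/-- The vector of the polynomial functions given by the twisted signs. -/
noncomputable def signVector (T : GenTriangulation n) (g : Fin n → Fin 4 → SignType)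
    (q : Fin n × stdSimplex ℝ (Fin 4)) : T.TwistedSign g → ℝ :=
  fun ε => ∑ s : Finset (Fin 4), (ε.val q.1 s : ℝ) * ∏ j ∈ s, q.2.1 j

theorem continuous_signVector : Continuous (T.signVector g) := by
  refine continuous_pi fun ε => continuous_finsetSum _ fun s _ => ?_
  refine Continuous.mul ?_ ?_
  · exact (continuous_of_discreteTopology (f := fun t => (ε.val t s : ℝ))).comp continuous_fst
  · exact continuous_finsetProd _ fun j _ =>
      (continuous_apply j).comp (continuous_subtype_val.comp continuous_snd)

/-- Monomials of faces containing `i` vanish at `p`; the remaining ones are permuted by the gluing,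
with factor `g`. -/
theorem signVector_eq_smul {p q : Fin n × stdSimplex ℝ (Fin 4)} {i : Fin 4} (h0 : p.2.1 i = 0)
    (h1 : q.1 = T.adj p.1 i) (h2 : ∀ j : Fin 4, q.2.1 (T.perm p.1 i j) = p.2.1 j) :
    T.signVector g q = (g p.1 i : ℝ) • T.signVector g p := by
  ext ε
  simp only [signVector, Pi.smul_apply, smul_eq_mul, Finset.mul_sum]
  refine (Fintype.sum_equiv (T.perm p.1 i).finsetCongr _ _ fun s => ?_).symm
  rw [Equiv.finsetCongr_apply, Finset.prod_map, h1]
  simp only [Equiv.coe_toEmbedding, h2]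
  by_cases hi : i ∈ s
  · simp [Finset.prod_eq_zero hi h0]
  · rw [ε.map_adj _ _ _ hi, SignType.coe_mul, mul_assoc]

theorem mk_signVector_eq {p q : Fin n × stdSimplex ℝ (Fin 4)} (hg : ∀ t i, g t i ≠ 0)
    (h : T.PointRel p q) : UpToSign.mk (T.signVector g p) = UpToSign.mk (T.signVector g q) := by
  obtain ⟨i, h0, h1, h2⟩ := h
  rw [signVector_eq_smul h0 h1 h2]
  have := hg p.1 i
  revert this
  generalize g p.1 i = x
  intro hx
  cases x
  · exact absurd rfl hx
  · simp [UpToSign.mk_neg]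
  · simp

/-- The vector of the twisted signs as a map up to sign from the underlying space. -/
noncomputable def signMap (T : GenTriangulation n) {g : Fin n → Fin 4 → SignType}
    (hg : ∀ t i, g t i ≠ 0) : T.Realization → UpToSign (T.TwistedSign g) :=
  Quot.lift (fun q => UpToSign.mk (T.signVector g q)) fun _ _ h => mk_signVector_eq hg h

theorem continuous_signMap (hg : ∀ t i, g t i ≠ 0) : Continuous (T.signMap hg) :=
  continuous_quot_lift _ (UpToSign.continuous_mk.comp continuous_signVector)

/-- Among the sets with as many elements as the support `s`, only `s` itself has a nonvanishing
monomial. Thus a twisted sign can be read off at an interior point of a face. -/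
theorem signVector_ofCard_card (ε : T.TwistedSign g) (q : Fin n × stdSimplex ℝ (Fin 4))
    {s : Finset (Fin 4)} (hs : ∀ j, j ∈ s ↔ q.2.1 j ≠ 0) :
    T.signVector g q (ε.ofCard s.card) = ε.val q.1 s * ∏ j ∈ s, q.2.1 j := by
  rw [signVector, Finset.sum_eq_single s]
  · simp [TwistedSign.ofCard]
  · intro s' _ hne
    by_cases hc : s'.card = s.card
    · have : ¬ s' ⊆ s := fun h => hne (Finset.eq_of_subset_of_card_le h hc.ge)
      obtain ⟨j, hj, hjs⟩ := Finset.not_subset.1 this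
      rw [hs, not_not] at hjs
      simp [Finset.prod_eq_zero hj hjs]
    · simp [TwistedSign.ofCard, hc]
  · simp

theorem signVector_vertex (h : T.IsSignCocycle χ g) (q : Fin n × stdSimplex ℝ (Fin 4)) :
    T.signVector g q (TwistedSign.vertex h) = ∑ j, (χ q.1 j : ℝ) * q.2.1 j := by
  have : ∀ s : Finset (Fin 4),
      (((TwistedSign.vertex h).val q.1 s : SignType) : ℝ) * ∏ j ∈ s, q.2.1 j =
      if s.card = 1 then ∏ j ∈ s, ((χ q.1 j : ℝ) * q.2.1 j) else 0 := by
    intro s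
    by_cases hs : s.card = 1
    · obtain ⟨a, rfl⟩ := Finset.card_eq_one.1 hs
      simp [TwistedSign.vertex]
    · simp [TwistedSign.vertex, hs]
  rw [signVector, Finset.sum_congr rfl fun s _ => this s, ← Finset.sum_filter,
    ← Finset.powerset_univ, Finset.powerset_univ, Finset.univ_filter_card_eq,
    Finset.powersetCard_one]
  simp

/-- The twisted signs can only vanish together at midpoints of edges. -/
theorem signVector_eq_zero (h : T.IsSignCocycle χ g) {q : Fin n × stdSimplex ℝ (Fin 4)}
    (hq : T.signVector g q = 0) : ∃ a b, a ≠ b ∧ q.2.1 a = 1 / 2 ∧ q.2.1 b = 1 / 2 ∧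
      ∀ ε : T.TwistedSign g, ε.val q.1 {a, b} = 0 := by
  classical
  let s : Finset (Fin 4) := Finset.univ.filter fun j => q.2.1 j ≠ 0
  have hs : ∀ j, j ∈ s ↔ q.2.1 j ≠ 0 := by simp [s]
  have hzero (ε : T.TwistedSign g) : ε.val q.1 s = 0 := by
    by_contra hne
    have := signVector_ofCard_card ε q hs
    rw [hq, Pi.zero_apply, eq_comm, mul_eq_zero, Finset.prod_eq_zero_iff] at this
    rcases this with h1 | ⟨j, hj, h1⟩
    · exact SignType.coe_real_ne_zero hne h1
    · exact (hs j).1 hj h1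
  have hsum : ∑ j, q.2.1 j = 1 := q.2.2.2
  have hout (f : Fin 4 → ℝ) : ∑ j, f j * q.2.1 j = ∑ j ∈ s, f j * q.2.1 j := by
    refine (Finset.sum_subset (Finset.subset_univ s) fun j _ hj => ?_).symm
    rw [hs, not_not] at hj
    rw [hj, mul_zero]
  have hcard : s.card = 0 ∨ s.card = 1 ∨ s.card = 2 ∨ s.card = 3 ∨ s.card = 4 := by
    have := Finset.card_le_univ s
    simp only [Fintype.card_fin] at this
    omega
  have hsum' := hout 1
  simp only [Pi.one_apply, one_mul, hsum] at hsum'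
  rcases hcard with hc | hc | hc | hc | hc
  · simp [Finset.card_eq_zero.1 hc] at hsum'
  · obtain ⟨a, ha⟩ := Finset.card_eq_one.1 hc
    have := hzero (TwistedSign.vertex h)
    simp only [TwistedSign.vertex, ha, Finset.card_singleton, if_true, Finset.prod_singleton] at this
    exact absurd this (h.vertex_ne_zero _ _)
  -- On an open edge the section of `TwistedSign.vertex` is `±x ± y`, which can vanish only for `x =
  -- y`.
  · obtain ⟨a, b, hab, hsab⟩ := Finset.card_eq_two.1 hc
    have h1 := congrFun hq (TwistedSign.vertex h)
    rw [signVector_vertex, hout, Pi.zero_apply, hsab, Finset.sum_pair hab] at h1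
    rw [hsab, Finset.sum_pair hab] at hsum'
    have ha := h.vertex_ne_zero q.1 a
    have hb := h.vertex_ne_zero q.1 b
    have h2 : q.2.1 a = q.2.1 b := by
      clear hout hzero hsum hsab
      rcases SignType.trichotomy (χ q.1 a) with hx | hx | hx <;>
      rcases SignType.trichotomy (χ q.1 b) with hy | hy | hy <;>
      first
        | exact absurd hx ha
        | exact absurd hy hb
        | (rw [hx, hy] at h1
           simp only [SignType.coe_one, SignType.coe_neg_one] at h1
           linarith)
    exact ⟨a, b, hab, by linarith, by linarith, by rw [← hsab]; exact hzero⟩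
  · obtain ⟨ε, hε⟩ := TwistedSign.exists_ne_zero_of_card_eq_three h q.1 hc
    exact absurd (hzero ε) hε
  · obtain ⟨ε, hε⟩ := TwistedSign.exists_ne_zero_of_card_eq_four (g := g) (T := T) q.1 hc
    exact absurd (hzero ε) hε

end GenTriangulation

/-! ### Points near midpoints of edges -/

theorem sign_eq_of_continuous {A : Type*} [TopologicalSpace A] [PreconnectedSpace A] {f : A → ℝ}
    (hf : Continuous f) (h0 : ∀ a, f a ≠ 0) (a b : A) :
    SignType.sign (f a) = SignType.sign (f b) := by
  refine PreconnectedSpace.constant inferInstance (f := fun a => SignType.sign (f a)) ?_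
  rw [continuous_iff_continuousAt]
  intro x
  exact ContinuousAt.comp (g := SignType.sign) (continuousAt_sign_of_ne_zero (h0 x)) hf.continuousAt

/-- The multiple of a vertex of the standard tetrahedron by a real number. -/
def axisVec (a : Fin 4) (x : ℝ) : Fin 4 → ℝ := fun j => if j = a then x else 0

theorem axisVec_apply (a : Fin 4) (x : ℝ) (j : Fin 4) : axisVec a x j = if j = a then x else 0 :=
  rfl

theorem axisVec_nonneg {a : Fin 4} {x : ℝ} (hx : 0 ≤ x) (j : Fin 4) : 0 ≤ axisVec a x j := by
  rw [axisVec_apply]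
  split_ifs
  · exact hx
  · exact le_rfl

theorem sum_axisVec (a : Fin 4) (x : ℝ) : ∑ j, axisVec a x j = x := by
  simp [axisVec]

theorem norm_axisVec_le (a : Fin 4) (x : ℝ) : ‖axisVec a x‖ ≤ |x| := by
  refine (pi_norm_le_iff_of_nonneg (abs_nonneg x)).2 fun j => ?_
  rw [axisVec_apply]
  split_ifs <;> simp

theorem axisVec_zero (a : Fin 4) : axisVec a 0 = 0 := by
  ext j
  simp [axisVec_apply]

/-- The point on the edge from vertex `b` to vertex `a` of the standard tetrahedron with
parameter `x`. -/
def edgePoint (a b : Fin 4) (x : Set.Icc (0 : ℝ) 1) : stdSimplex ℝ (Fin 4) :=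
  ⟨axisVec a x.1 + axisVec b (1 - x.1), by
    refine ⟨fun j => add_nonneg (axisVec_nonneg x.2.1 j)
      (axisVec_nonneg (sub_nonneg.2 x.2.2) j), ?_⟩
    simp [Finset.sum_add_distrib, sum_axisVec]⟩

/-- The point with parameter `u` on an arc in the triangle `a b i` that joins two points on the
edge `a b` and avoids its midpoint if `δ ≠ 0`. -/
noncomputable def bentEdge (a b i : Fin 4) (δ : Set.Icc (0 : ℝ) (1 / 4)) (u : Set.Icc (-1 : ℝ) 1) :
    stdSimplex ℝ (Fin 4) :=
  ⟨axisVec a (1 / 2 + δ.1 * (u.1 - (1 - u.1 ^ 2))) +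
    axisVec b (1 / 2 + δ.1 * (-u.1 - (1 - u.1 ^ 2))) + axisVec i (2 * δ.1 * (1 - u.1 ^ 2)), by
    obtain ⟨δ, h1, h2⟩ := δ
    obtain ⟨u, h3, h4⟩ := u
    have h5 : 0 ≤ 1 - u ^ 2 := by nlinarith
    refine ⟨fun j => add_nonneg (add_nonneg (axisVec_nonneg ?_ j) (axisVec_nonneg ?_ j))
      (axisVec_nonneg ?_ j), ?_⟩
    · dsimp only
      nlinarith [sq_nonneg u]
    · dsimp only
      nlinarith [sq_nonneg u]
    · positivity
    · simp [Finset.sum_add_distrib, sum_axisVec]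
      ring⟩

theorem continuous_bentEdge (a b i : Fin 4) (δ : Set.Icc (0 : ℝ) (1 / 4)) :
    Continuous (bentEdge a b i δ) := by
  refine Continuous.subtype_mk (continuous_pi fun j => ?_) _
  simp only [Pi.add_apply, axisVec_apply]
  refine (Continuous.add ?_ ?_).add ?_ <;>
  · split_ifs <;> fun_prop

/-- The point on the edge `a b` at parameter distance `δ` from the midpoint. -/
noncomputable def nearMidpoint (a b : Fin 4) (δ : Set.Icc (0 : ℝ) (1 / 4)) :
    stdSimplex ℝ (Fin 4) :=
  edgePoint a b ⟨1 / 2 + δ, by have := δ.2.1; linarith, by have := δ.2.2; linarith⟩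

theorem bentEdge_one (a b i : Fin 4) (δ : Set.Icc (0 : ℝ) (1 / 4)) :
    bentEdge a b i δ ⟨1, by norm_num⟩ = nearMidpoint a b δ := by
  apply Subtype.ext
  change axisVec a (1 / 2 + δ.1 * (1 - (1 - 1 ^ 2))) +
    axisVec b (1 / 2 + δ.1 * (-1 - (1 - 1 ^ 2))) + axisVec i (2 * δ.1 * (1 - 1 ^ 2)) =
    axisVec a (1 / 2 + δ.1) + axisVec b (1 - (1 / 2 + δ.1))
  have e1 : 1 / 2 + δ.1 * (1 - (1 - 1 ^ 2)) = 1 / 2 + δ.1 := by ring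
  have e2 : 1 / 2 + δ.1 * (-1 - (1 - 1 ^ 2)) = 1 - (1 / 2 + δ.1) := by ring
  have e3 : 2 * δ.1 * (1 - 1 ^ 2) = 0 := by ring
  rw [e1, e2, e3, axisVec_zero, add_zero]

theorem bentEdge_neg_one (a b i : Fin 4) (δ : Set.Icc (0 : ℝ) (1 / 4)) :
    bentEdge a b i δ ⟨-1, by norm_num⟩ = nearMidpoint b a δ := by
  apply Subtype.ext
  change axisVec a (1 / 2 + δ.1 * (-1 - (1 - (-1) ^ 2))) +
    axisVec b (1 / 2 + δ.1 * (- -1 - (1 - (-1) ^ 2))) + axisVec i (2 * δ.1 * (1 - (-1) ^ 2)) =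
    axisVec b (1 / 2 + δ.1) + axisVec a (1 - (1 / 2 + δ.1))
  have e1 : 1 / 2 + δ.1 * (- -1 - (1 - (-1) ^ 2)) = 1 / 2 + δ.1 := by ring
  have e2 : 1 / 2 + δ.1 * (-1 - (1 - (-1) ^ 2)) = 1 - (1 / 2 + δ.1) := by ring
  have e3 : 2 * δ.1 * (1 - (-1) ^ 2) = 0 := by ring
  rw [e1, e2, e3, axisVec_zero, add_zero, add_comm]

theorem dist_bentEdge_le (a b i : Fin 4) (δ : Set.Icc (0 : ℝ) (1 / 4)) (u : Set.Icc (-1 : ℝ) 1) :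
    dist (bentEdge a b i δ u) (nearMidpoint a b ⟨0, by norm_num⟩) ≤ 6 * δ := by
  obtain ⟨δ, h1, h2⟩ := δ
  obtain ⟨u, h3, h4⟩ := u
  rw [Subtype.dist_eq, dist_eq_norm]
  have : (bentEdge a b i ⟨δ, h1, h2⟩ ⟨u, h3, h4⟩).1 - (nearMidpoint a b ⟨0, by norm_num⟩).1 =
      axisVec a (δ * (u - (1 - u ^ 2))) + axisVec b (δ * (-u - (1 - u ^ 2))) +
      axisVec i (2 * δ * (1 - u ^ 2)) := by
    ext j
    simp only [bentEdge, nearMidpoint, edgePoint, Pi.sub_apply, Pi.add_apply, axisVec_apply]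
    split_ifs <;> ring
  rw [this]
  refine (norm_add₃_le).trans ?_
  refine (add_le_add (add_le_add (norm_axisVec_le _ _) (norm_axisVec_le _ _))
    (norm_axisVec_le _ _)).trans ?_
  have hu : u ^ 2 ≤ 1 := by nlinarith
  have hu0 := sq_nonneg u
  have h (x : ℝ) (hx : -2 ≤ x) (hx' : x ≤ 2) : |δ * x| ≤ δ * 2 := by
    rw [abs_mul, abs_of_nonneg h1]
    exact mul_le_mul_of_nonneg_left (abs_le.2 ⟨hx, hx'⟩) h1
  have e1 := h (u - (1 - u ^ 2)) (by linarith) (by linarith)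
  have e2 := h (-u - (1 - u ^ 2)) (by linarith) (by linarith)
  have e3 := h (2 * (1 - u ^ 2)) (by linarith) (by linarith)
  rw [← mul_assoc, mul_comm δ 2] at e3
  linarith

/-- The coordinate at `i` is at most `2δ ≤ 1/4`, so the two coordinates `1/2` could only be at `a`
and `b`. This would force both `u = 0` and `u ^ 2 = 1`. -/
theorem bentEdge_ne_midpoint {a b i : Fin 4} (hab : a ≠ b) (hai : a ≠ i) (hbi : b ≠ i)
    (δ : Set.Icc (0 : ℝ) (1 / 4)) (h0 : 0 < δ.1) (h8 : δ.1 ≤ 1 / 8) (u : Set.Icc (-1 : ℝ) 1)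
    {c d : Fin 4} (hcd : c ≠ d) (hc : (bentEdge a b i δ u).1 c = 1 / 2)
    (hd : (bentEdge a b i δ u).1 d = 1 / 2) : False := by
  obtain ⟨δ, h1, h2⟩ := δ
  obtain ⟨u, h3, h4⟩ := u
  have ha : (bentEdge a b i ⟨δ, h1, h2⟩ ⟨u, h3, h4⟩).1 a = 1 / 2 + δ * (u - (1 - u ^ 2)) := by
    simp [bentEdge, axisVec_apply, hab, hai]
  have hb : (bentEdge a b i ⟨δ, h1, h2⟩ ⟨u, h3, h4⟩).1 b = 1 / 2 + δ * (-u - (1 - u ^ 2)) := by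
    simp [bentEdge, axisVec_apply, hab.symm, hbi]
  have hi : (bentEdge a b i ⟨δ, h1, h2⟩ ⟨u, h3, h4⟩).1 i = 2 * δ * (1 - u ^ 2) := by
    simp [bentEdge, axisVec_apply, hai.symm, hbi.symm]
  have key : ∀ j, (bentEdge a b i ⟨δ, h1, h2⟩ ⟨u, h3, h4⟩).1 j = 1 / 2 → j = a ∨ j = b := by
    intro j hj
    by_contra! hne
    by_cases hji : j = i
    · rw [hji, hi] at hj
      dsimp only at h0 h8
      nlinarith [sq_nonneg u]
    · simp [bentEdge, axisVec_apply, hne.1, hne.2, hji] at hj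
  have hboth : (bentEdge a b i ⟨δ, h1, h2⟩ ⟨u, h3, h4⟩).1 a = 1 / 2 ∧
      (bentEdge a b i ⟨δ, h1, h2⟩ ⟨u, h3, h4⟩).1 b = 1 / 2 := by
    rcases key c hc with rfl | rfl <;> rcases key d hd with rfl | rfl <;> simp_all
  rw [ha, hb] at hboth
  have e1 : u - (1 - u ^ 2) = 0 := by
    have := mul_eq_zero.1 (show δ * (u - (1 - u ^ 2)) = 0 by linarith [hboth.1])
    exact this.resolve_left h0.ne'
  have e2 : -u - (1 - u ^ 2) = 0 := by
    have := mul_eq_zero.1 (show δ * (-u - (1 - u ^ 2)) = 0 by linarith [hboth.2])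
    exact this.resolve_left h0.ne'
  have e3 : u = 0 := by linarith
  subst e3
  norm_num at e1

theorem eq_nearMidpoint_zero {p : stdSimplex ℝ (Fin 4)} {a b : Fin 4} (hab : a ≠ b)
    (ha : p.1 a = 1 / 2) (hb : p.1 b = 1 / 2) : p = nearMidpoint a b ⟨0, by norm_num⟩ := by
  have hsum := p.2.2
  have hp := p.2.1
  have h3 := Finset.sum_erase_add Finset.univ p.1 (Finset.mem_univ a)
  have hb' : b ∈ Finset.univ.erase a := by simp [hab.symm]
  have h4 := Finset.sum_erase_add _ p.1 hb'
  have h5 : ∑ x ∈ (Finset.univ.erase a).erase b, p.1 x = 0 := by linarith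
  rw [Finset.sum_eq_zero_iff_of_nonneg fun i _ => hp i] at h5
  apply Subtype.ext
  funext j
  by_cases hja : j = a
  · subst hja
    simp [nearMidpoint, edgePoint, axisVec_apply, hab, ha]
  · by_cases hjb : j = b
    · subst hjb
      simp [nearMidpoint, edgePoint, axisVec_apply, hja, hb]
      norm_num
    · rw [h5 j (by simp [hja, hjb])]
      simp [nearMidpoint, edgePoint, axisVec_apply, hja, hjb]

/-! ### Signs in a punctured neighbourhood -/

namespace GenTriangulation

variable {n : ℕ} {T : GenTriangulation n} {χ g : Fin n → Fin 4 → SignType}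

/-- The quotient map from the disjoint union of the tetrahedra. -/
def toRealization (T : GenTriangulation n) (q : Fin n × stdSimplex ℝ (Fin 4)) : T.Realization :=
  Quot.mk _ q

theorem continuous_toRealization : Continuous T.toRealization := continuous_quot_mk

theorem signMap_toRealization (hg : ∀ t i, g t i ≠ 0) (q : Fin n × stdSimplex ℝ (Fin 4)) :
    T.signMap hg (T.toRealization q) = UpToSign.mk (T.signVector g q) := rfl

theorem pointRel_edgePoint {t : Fin n} {i a b : Fin 4} (ha : i ≠ a) (hb : i ≠ b)
    (x : Set.Icc (0 : ℝ) 1) : T.PointRel (t, edgePoint a b x)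
      (T.adj t i, edgePoint (T.perm t i a) (T.perm t i b) x) := by
  refine ⟨i, by simp [edgePoint, axisVec_apply, ha, hb], rfl, fun j => ?_⟩
  simp [edgePoint, axisVec_apply]

/-- Near a point with a punctured neighbourhood that is a punctured real vector space of dimension
at least three the sign vectors have consistent signs. -/
theorem exists_local_sign (h : T.IsSignCocycle χ g) {E : Type*} [NormedAddCommGroup E]
    [NormedSpace ℝ E] (hE : 2 < Module.rank ℝ E) {ψ : E → T.Realization} (hψ : IsOpenEmbedding ψ)
    (h0 : ∀ x, x ≠ 0 → T.signMap h.face_ne_zero (ψ x) ≠ UpToSign.mk 0) :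
    ∃ σ : Fin n × stdSimplex ℝ (Fin 4) → SignType,
      (∀ q, T.toRealization q ∈ Set.range ψ \ {ψ 0} → σ q ≠ 0) ∧
      (∀ c : Set.Icc (-1 : ℝ) 1 → Fin n × stdSimplex ℝ (Fin 4), Continuous c →
        (∀ u, T.toRealization (c u) ∈ Set.range ψ \ {ψ 0}) → ∀ u v, σ (c u) = σ (c v)) ∧
      ∀ p i q, p.2.1 i = 0 → q.1 = T.adj p.1 i → (∀ j, q.2.1 (T.perm p.1 i j) = p.2.1 j) →
        σ q = g p.1 i * σ p := by
  classical
  have := Fintype.ofFinite (T.TwistedSign g)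
  obtain ⟨w, hw, hwF⟩ := UpToSign.exists_lift_compl_zero hE
    (F := fun x => T.signMap h.face_ne_zero (ψ x))
    ((continuous_signMap _).comp hψ.continuous).continuousOn h0
  let e := hψ.toOpenPartialHomeomorph ψ
  -- The inner product of the sign vector with the lift `w`. It is plus or minus a squared norm,
  -- hence nonzero. Since `w` depends only on the point of the quotient, `f` changes by `g` along
  -- gluings.
  let f : Fin n × stdSimplex ℝ (Fin 4) → ℝ := fun q =>
    ∑ ε, T.signVector g q ε * w (e.symm (T.toRealization q)) ε
  have he (x : E) : e.symm (ψ x) = x := e.left_inv (by simp [e])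
  have hf0 (q) (hq : T.toRealization q ∈ Set.range ψ \ {ψ 0}) : f q ≠ 0 := by
    obtain ⟨⟨x, hx⟩, hne⟩ := hq
    have hx0 : x ≠ 0 := by
      rintro rfl
      exact hne hx.symm
    have h1 := hwF x hx0
    have h2 := h0 x hx0
    simp only [hx, signMap_toRealization] at h1 h2
    have h3 : ∑ ε, T.signVector g q ε * T.signVector g q ε ≠ 0 := by
      intro h4
      rw [Finset.sum_eq_zero_iff_of_nonneg fun _ _ => mul_self_nonneg _] at h4
      apply h2
      rw [UpToSign.mk_eq_mk_zero]
      ext ε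
      exact mul_self_eq_zero.1 (h4 ε (Finset.mem_univ _))
    simp only [f, ← hx, he]
    rcases UpToSign.mk_eq_mk.1 h1 with h5 | h5
    · rwa [h5]
    · rw [h5]
      simpa using h3
  refine ⟨fun q => SignType.sign (f q), fun q hq => sign_ne_zero.2 (hf0 q hq), ?_, ?_⟩
  · intro c hc hcW u v
    have : PreconnectedSpace (Set.Icc (-1 : ℝ) 1) :=
      Subtype.preconnectedSpace isPreconnected_Icc
    refine sign_eq_of_continuous (f := fun u => f (c u)) ?_ (fun u => hf0 _ (hcW u)) u v
    refine continuous_finsetSum _ fun ε _ => ?_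
    refine ((continuous_apply ε).comp (continuous_signVector.comp hc)).mul
      ((continuous_apply ε).comp ?_)
    refine hw.comp_continuous (f := fun u => e.symm (T.toRealization (c u))) ?_ ?_
    · refine e.continuousOn_symm.comp_continuous (continuous_toRealization.comp hc) fun u => ?_
      simpa [e] using (hcW u).1
    · intro u hu
      obtain ⟨⟨x, hx⟩, hne⟩ := hcW u
      apply hne
      have hu' : e.symm (T.toRealization (c u)) = 0 := hu
      rw [← hx, he] at hu'
      rw [← hx, hu']
      rfl
  · intro p i q h1 h2 h3
    have hpq : T.toRealization q = T.toRealization p := (Quot.sound ⟨i, h1, h2, h3⟩).symm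
    have : f q = (g p.1 i : ℝ) * f p := by
      simp only [f, signVector_eq_smul h1 h2 h3, hpq, Finset.mul_sum, Pi.smul_apply, smul_eq_mul,
        mul_assoc]
    dsimp only
    rw [this, sign_mul]
    congr 1
    rcases SignType.trichotomy (g p.1 i) with h | h | h <;> simp [h]

end GenTriangulation

/-! ### Twisted signs on manifolds -/

/-- A small ball in a chart is homeomorphic to all of `E`. -/
theorem exists_isOpenEmbedding_of_chartedSpace {E : Type*} [NormedAddCommGroup E]
    [NormedSpace ℝ E] {M : Type*} [TopologicalSpace M] [ChartedSpace E M] (x : M) {U : Set M}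
    (hU : U ∈ 𝓝 x) : ∃ ψ : E → M, IsOpenEmbedding ψ ∧ ψ 0 = x ∧ Set.range ψ ⊆ U := by
  let e := chartAt E x
  have hV : e.target ∩ e.symm ⁻¹' U ∈ 𝓝 (e x) := by
    refine Filter.inter_mem (e.open_target.mem_nhds (mem_chart_target E x)) ?_
    refine (e.continuousAt_symm (mem_chart_target E x)).preimage_mem_nhds ?_
    rwa [e.left_inv (mem_chart_source E x)]
  obtain ⟨r, hr, hrV⟩ := Metric.mem_nhds_iff.1 hV
  let f := (OpenPartialHomeomorph.univBall (e x) r).trans e.symm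
  have hf : f.source = Set.univ := by
    rw [OpenPartialHomeomorph.trans_source, OpenPartialHomeomorph.univBall_source, Set.univ_inter,
      Set.eq_univ_iff_forall]
    intro y
    refine (hrV ?_).1
    rw [← OpenPartialHomeomorph.univBall_target (e x) hr]
    exact (OpenPartialHomeomorph.univBall (e x) r).map_source (by simp)
  refine ⟨f, f.isOpenEmbedding hf, ?_, ?_⟩
  · simp [f, e.left_inv (mem_chart_source E x)]
  · rintro _ ⟨y, rfl⟩
    refine (hrV ?_).2
    rw [← OpenPartialHomeomorph.univBall_target (e x) hr]
    exact (OpenPartialHomeomorph.univBall (e x) r).map_source (by simp)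

namespace GenTriangulation

variable {n : ℕ} {T : GenTriangulation n} {χ g : Fin n → Fin 4 → SignType}

/-- The local sign is evaluated on each edge whose midpoint is `ψ 0`, at a fixed small distance from
the midpoint, and extended by zero to all other faces. -/
theorem exists_twistedSign_ne_zero (h : T.IsSignCocycle χ g) {E : Type*} [NormedAddCommGroup E]
    [NormedSpace ℝ E] (hE : 2 < Module.rank ℝ E) {ψ : E → T.Realization} (hψ : IsOpenEmbedding ψ)
    (h0 : ∀ x, x ≠ 0 → T.signMap h.face_ne_zero (ψ x) ≠ UpToSign.mk 0)
    (h00 : T.signMap h.face_ne_zero (ψ 0) = UpToSign.mk 0) {t₀ : Fin n} {a₀ b₀ : Fin 4}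
    (hab₀ : a₀ ≠ b₀) (hm : ψ 0 = T.toRealization (t₀, nearMidpoint a₀ b₀ ⟨0, by norm_num⟩)) :
    ∃ ε : T.TwistedSign g, ε.val t₀ {a₀, b₀} ≠ 0 := by
  classical
  obtain ⟨σ, hσ0, hσc, hσg⟩ := exists_local_sign h hE hψ h0
  let Mid : Fin n → Fin 4 → Fin 4 → Prop := fun t a b =>
    T.toRealization (t, nearMidpoint a b ⟨0, by norm_num⟩) = ψ 0
  have hr (t : Fin n) (a b : Fin 4) : ∃ r > 0, Mid t a b →
      ∀ p, dist p (nearMidpoint a b ⟨0, by norm_num⟩) < r → T.toRealization (t, p) ∈ Set.range ψ := by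
    by_cases hM : Mid t a b
    · have ho : IsOpen {p : stdSimplex ℝ (Fin 4) | T.toRealization (t, p) ∈ Set.range ψ} :=
        hψ.isOpen_range.preimage (continuous_toRealization.comp (by fun_prop))
      obtain ⟨r, hr, hb⟩ := Metric.isOpen_iff.1 ho (nearMidpoint a b ⟨0, by norm_num⟩)
        ⟨0, hM.symm⟩
      exact ⟨r, hr, fun _ p hp => hb hp⟩
    · exact ⟨1, one_pos, fun h => absurd h hM⟩
  choose r hr0 hr using hr
  -- One `δ` serves all edges, so that gluings match the evaluation points. The factor 6 is that of
  -- `dist_bentEdge_le`, and `1 / 8` that of `bentEdge_ne_midpoint`.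
  obtain ⟨δ, hδ0, hδ8, hδr⟩ : ∃ δ : ℝ, 0 < δ ∧ δ ≤ 1 / 8 ∧ ∀ t a b, 6 * δ < r t a b := by
    have h1 : ∀ᶠ δ : ℝ in 𝓝[>] 0, δ ≤ 1 / 8 :=
      nhdsWithin_le_nhds (Iic_mem_nhds (by norm_num))
    have h2 : ∀ᶠ δ : ℝ in 𝓝[>] 0, ∀ t a b, 6 * δ < r t a b := by
      simp only [Filter.eventually_all]
      intro t a b
      have : ∀ᶠ δ : ℝ in 𝓝 0, 6 * δ < r t a b :=
        ContinuousAt.eventually_lt (by fun_prop) continuousAt_const (by simpa using hr0 t a b)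
      exact nhdsWithin_le_nhds this
    obtain ⟨δ, ⟨h3, h4⟩, h5⟩ := ((h1.and h2).and self_mem_nhdsWithin).exists
    exact ⟨δ, h5, h3, h4⟩
  let D : Set.Icc (0 : ℝ) (1 / 4) := ⟨δ, hδ0.le, by linarith⟩
  have hW (t : Fin n) (a b i : Fin 4) (hab : a ≠ b) (hai : a ≠ i) (hbi : b ≠ i) (hM : Mid t a b)
      (u : Set.Icc (-1 : ℝ) 1) :
      T.toRealization (t, bentEdge a b i D u) ∈ Set.range ψ \ {ψ 0} := by
    refine ⟨hr t a b hM _ ((dist_bentEdge_le a b i D u).trans_lt (hδr t a b)), ?_⟩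
    intro hu
    rw [Set.mem_singleton_iff] at hu
    rw [← hu, signMap_toRealization, UpToSign.mk_eq_mk_zero] at h00
    obtain ⟨c, d, hcd, hc, hd, -⟩ := signVector_eq_zero h h00
    exact bentEdge_ne_midpoint hab hai hbi D hδ0 hδ8 u hcd hc hd
  let θ : Fin n → Fin 4 → Fin 4 → SignType := fun t a b => σ (t, nearMidpoint a b D)
  have hthird : ∀ a b : Fin 4, ∃ i, a ≠ i ∧ b ≠ i := by decide
  have hθ0 (t a b) (hab : a ≠ b) (hM : Mid t a b) : θ t a b ≠ 0 := by
    obtain ⟨i, hai, hbi⟩ := hthird a b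
    have := hW t a b i hab hai hbi hM ⟨1, by norm_num⟩
    rw [bentEdge_one] at this
    exact hσ0 _ this
  -- The arc around the midpoint joins the evaluation points on its two sides, so the sign belongs
  -- to the unoriented edge.
  have hθsymm (t a b) (hab : a ≠ b) (hM : Mid t a b) : θ t a b = θ t b a := by
    obtain ⟨i, hai, hbi⟩ := hthird a b
    have := hσc (fun u => (t, bentEdge a b i D u))
      (continuous_const.prodMk (continuous_bentEdge a b i D)) (hW t a b i hab hai hbi hM)
      ⟨1, by norm_num⟩ ⟨-1, by norm_num⟩
    simpa only [bentEdge_one, bentEdge_neg_one] using this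
  have hMadj (t i a b) (ha : i ≠ a) (hb : i ≠ b) :
      Mid (T.adj t i) (T.perm t i a) (T.perm t i b) ↔ Mid t a b := by
    have : T.toRealization (t, nearMidpoint a b ⟨0, by norm_num⟩) = T.toRealization
        (T.adj t i, nearMidpoint (T.perm t i a) (T.perm t i b) ⟨0, by norm_num⟩) :=
      Quot.sound (pointRel_edgePoint ha hb _)
    simp only [Mid, this]
  have hθadj (t i a b) (ha : i ≠ a) (hb : i ≠ b) :
      θ (T.adj t i) (T.perm t i a) (T.perm t i b) = g t i * θ t a b := by
    refine hσg (t, nearMidpoint a b D) i _ ?_ rfl ?_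
    · simp [nearMidpoint, edgePoint, axisVec_apply, ha, hb]
    · simp [nearMidpoint, edgePoint, axisVec_apply]
  have hex (t : Fin n) (s : Finset (Fin 4)) : ∃ x : SignType,
      (∀ a b, a ≠ b → s = {a, b} → Mid t a b → x = θ t a b) ∧
      ((∀ a b, a ≠ b → s = {a, b} → ¬ Mid t a b) → x = 0) := by
    by_cases hs : ∃ a b, a ≠ b ∧ s = {a, b} ∧ Mid t a b
    · obtain ⟨a, b, hab, rfl, hM⟩ := hs
      refine ⟨θ t a b, ?_, fun h => absurd hM (h a b hab rfl)⟩
      intro c d hcd hs _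
      have hs' : ({a, b} : Set (Fin 4)) = {c, d} := by
        have := congrArg (fun s : Finset (Fin 4) => (s : Set (Fin 4))) hs
        simpa using this
      rcases Set.pair_eq_pair_iff.1 hs' with ⟨rfl, rfl⟩ | ⟨rfl, rfl⟩
      · rfl
      · exact hθsymm t _ _ hab hM
    · push Not at hs
      exact ⟨0, fun a b hab h1 h2 => absurd h2 (hs a b hab h1), fun _ => rfl⟩
  choose x hx1 hx2 using hex
  refine ⟨⟨x, ?_⟩, ?_⟩
  · intro t i s hi
    by_cases hs : ∃ a b, a ≠ b ∧ s = {a, b} ∧ Mid t a b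
    · obtain ⟨a, b, hab, rfl, hM⟩ := hs
      simp only [Finset.mem_insert, Finset.mem_singleton, not_or] at hi
      rw [hx1 t {a, b} a b hab rfl hM, ← hθadj t i a b hi.1 hi.2]
      refine hx1 _ _ _ _ (fun h => hab ((T.perm t i).injective h)) ?_
        ((hMadj t i a b hi.1 hi.2).2 hM)
      simp [Finset.map_insert]
    · push Not at hs
      rw [hx2 t s hs, mul_zero]
      refine hx2 _ _ fun c d hcd hs' hM => ?_
      obtain ⟨a, rfl⟩ := (T.perm t i).surjective c
      obtain ⟨b, rfl⟩ := (T.perm t i).surjective d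
      have hs2 : s = {a, b} := by
        apply Finset.map_injective (T.perm t i).toEmbedding
        rw [hs']
        simp [Finset.map_insert]
      subst hs2
      simp only [Finset.mem_insert, Finset.mem_singleton, not_or] at hi
      exact hs a b (fun h => hcd (by rw [h])) rfl ((hMadj t i a b hi.1 hi.2).1 hM)
  · change x t₀ {a₀, b₀} ≠ 0
    rw [hx1 t₀ {a₀, b₀} a₀ b₀ hab₀ rfl hm.symm]
    exact hθ0 t₀ a₀ b₀ hab₀ hm.symm

/-- On a closed manifold of dimension at least three the twisted signs have no common zero. -/
theorem signMap_ne_zero (h : T.IsSignCocycle χ g) {E : Type*} [NormedAddCommGroup E]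
    [NormedSpace ℝ E] (hE : 2 < Module.rank ℝ E) [T2Space T.Realization]
    (hloc : ∀ (m : T.Realization), ∀ U ∈ 𝓝 m,
      ∃ ψ : E → T.Realization, IsOpenEmbedding ψ ∧ ψ 0 = m ∧ Set.range ψ ⊆ U)
    (x : T.Realization) :
    T.signMap h.face_ne_zero x ≠ UpToSign.mk 0 := by
  intro hx
  obtain ⟨⟨t, p⟩, rfl⟩ := Quot.exists_rep x
  rw [← toRealization, signMap_toRealization, UpToSign.mk_eq_mk_zero] at hx
  obtain ⟨a, b, hab, ha, hb, hε⟩ := signVector_eq_zero h hx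
  have hp := eq_nearMidpoint_zero hab ha hb
  dsimp only at hp
  subst hp
  -- The zeros are finitely many, hence closed in a Hausdorff space. The neighbourhood of `m` can be
  -- shrunk until `m` is its only zero.
  let B : Set T.Realization := {y | T.signMap h.face_ne_zero y = UpToSign.mk 0}
  have hB : B.Finite := by
    refine (Set.finite_range fun z : Fin n × Fin 4 × Fin 4 =>
      T.toRealization (z.1, nearMidpoint z.2.1 z.2.2 ⟨0, by norm_num⟩)).subset ?_
    intro y hy
    obtain ⟨⟨t, p⟩, rfl⟩ := Quot.exists_rep y
    have hy' : UpToSign.mk (T.signVector g (t, p)) = UpToSign.mk 0 := hy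
    rw [UpToSign.mk_eq_mk_zero] at hy'
    obtain ⟨a, b, hab, ha, hb, -⟩ := signVector_eq_zero h hy'
    refine ⟨(t, a, b), ?_⟩
    change T.toRealization (t, nearMidpoint a b ⟨0, by norm_num⟩) = T.toRealization (t, p)
    rw [← eq_nearMidpoint_zero (p := p) hab ha hb]
  let m := T.toRealization (t, nearMidpoint a b ⟨0, by norm_num⟩)
  have hU : (B \ {m})ᶜ ∈ 𝓝 m :=
    (hB.subset Set.sdiff_subset).isClosed.isOpen_compl.mem_nhds (by simp)
  obtain ⟨ψ, hψ, hψ0, hψU⟩ := hloc m _ hU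
  obtain ⟨ε, hne⟩ := exists_twistedSign_ne_zero h hE hψ (fun y hy hF =>
    hψU ⟨y, rfl⟩ ⟨hF, fun hm => hy (hψ.injective (hm.trans hψ0.symm))⟩)
    (by rw [hψ0]; exact UpToSign.mk_eq_mk_zero.2 hx) hab hψ0
  exact hne (hε ε)

/-- In a one-vertex triangulation all vertices are the same point. -/
theorem toRealization_vertex_eq (hv : T.IsOneVertex) (t : Fin n) (a b : Fin 4) :
    T.toRealization (t, stdSimplex.vertex a) = T.toRealization (t, stdSimplex.vertex b) := by
  classical
  let c : Fin n × {s : Finset (Fin 4) // s.card = 0 + 1} → Fin n × stdSimplex ℝ (Fin 4) := fun p =>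
    (p.1, ⟨fun j => if j ∈ p.2.1 then 1 else 0, fun j => by dsimp only; split_ifs <;> simp, by
      simp [p.2.2]⟩)
  let f : T.Vertex → T.Realization := Quot.lift (fun p => T.toRealization (c p)) (by
    rintro ⟨t, s, hs⟩ ⟨t', s', hs'⟩ ⟨i, h1, h2, h3⟩
    dsimp only at h1 h2 h3
    subst h2 h3
    refine Quot.sound ⟨i, ?_, rfl, fun j => ?_⟩
    · simp [c, h1]
    · simp [c])
  have : Subsingleton T.Vertex := (Nat.card_eq_one_iff_unique.1 hv).1
  let v (a : Fin 4) : T.Vertex := Quot.mk _ (t, ⟨{a}, by simp⟩)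
  have hf (a : Fin 4) : f (v a) =
      T.toRealization (t, stdSimplex.vertex a) := by
    change T.toRealization (c _) = _
    congr 1
    refine Prod.ext rfl (Subtype.ext (funext fun j => ?_))
    simp [c, Pi.single_apply]
  rw [← hf a, ← hf b]
  exact congrArg f (Subsingleton.elim (v a) (v b))

/-- The edge from `a` to `b` is a closed path that `signVector` lifts. The lift closes up, and its
coordinate `TwistedSign.vertex` compares the two signs. -/
theorem IsSignCocycle.vertex_eq (h : T.IsSignCocycle χ g) {M : Type u} [TopologicalSpace M]
    [T2Space M] {E : Type*} [NormedAddCommGroup E]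
    [NormedSpace ℝ E] (hE : 2 < Module.rank ℝ E) [ChartedSpace E M]
    (hM : TrivialFirstHomologyModTwo M) (e : T.Realization ≃ₜ M) (hv : T.IsOneVertex)
    (t : Fin n) (a b : Fin 4) : χ t a = χ t b := by
  have : T2Space T.Realization := e.symm.t2Space
  have hloc (m : T.Realization) (U : Set T.Realization) (hU : U ∈ 𝓝 m) :
      ∃ ψ : E → T.Realization, IsOpenEmbedding ψ ∧ ψ 0 = m ∧ Set.range ψ ⊆ U := by
    obtain ⟨ψ, h1, h2, h3⟩ := exists_isOpenEmbedding_of_chartedSpace (E := E) (e m)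
      (U := e.symm ⁻¹' U) (e.symm.continuous.continuousAt.preimage_mem_nhds (by simpa using hU))
    refine ⟨e.symm ∘ ψ, e.symm.isOpenEmbedding.comp h1, by simp [h2], ?_⟩
    rintro _ ⟨y, rfl⟩
    exact h3 ⟨y, rfl⟩
  let p : stdSimplex ℝ (Fin 2) → Fin n × stdSimplex ℝ (Fin 4) := fun x =>
    (t, stdSimplex.map ![a, b] x)
  have hp : Continuous p := continuous_const.prodMk (stdSimplex.continuous_map _)
  have key := hM.lift_closed (F := fun x => T.signMap h.face_ne_zero (e.symm x))
    ((continuous_signMap _).comp e.symm.continuous) (fun x => signMap_ne_zero h hE hloc _)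
    ⟨fun x => e (T.toRealization (p x)), e.continuous.comp (continuous_toRealization.comp hp)⟩
    (by simpa [p] using toRealization_vertex_eq hv t a b)
    (w := fun x => T.signVector g (p x)) (continuous_signVector.comp hp)
    (fun x => by simp [signMap_toRealization])
  have hvert (c : Fin 4) : T.signVector g (t, stdSimplex.vertex c) (TwistedSign.vertex h) =
      χ t c := by
    simp [signVector_vertex, Pi.single_apply]
  have := congrFun key (TwistedSign.vertex h)
  simp only [p, stdSimplex.map_vertex] at this
  rw [hvert, hvert] at this
  simp only [Matrix.cons_val_zero, Matrix.cons_val_one] at this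
  rcases SignType.trichotomy (χ t a) with h1 | h1 | h1 <;>
  rcases SignType.trichotomy (χ t b) with h2 | h2 | h2 <;>
  · rw [h1, h2] at this ⊢
    try norm_num at this

end GenTriangulation

/-! ### Cocycles on the edges -/

namespace GenTriangulation

variable {n : ℕ} {T : GenTriangulation n}

theorem edge_comm (t : Fin n) {a b : Fin 4} (h : a ≠ b) : T.edge t a b h = T.edge t b a h.symm := by
  have : ({a, b} : Finset (Fin 4)) = {b, a} := Finset.pair_comm a b
  simp only [edge, this]
  rfl

theorem edge_adj (t : Fin n) {i a b : Fin 4} (hab : a ≠ b) (ha : i ≠ a) (hb : i ≠ b) :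
    T.edge (T.adj t i) (T.perm t i a) (T.perm t i b) (fun h => hab ((T.perm t i).injective h)) =
      T.edge t a b hab := by
  refine (Quot.sound ⟨i, ?_, rfl, ?_⟩).symm
  · simp [ha, hb]
  · simp [Finset.map_insert]

theorem exists_edge_eq (e : T.Edge) : ∃ t a b, ∃ h : a ≠ b, e = T.edge t a b h := by
  obtain ⟨⟨t, s, hs⟩, rfl⟩ := Quot.exists_rep e
  obtain ⟨a, b, hab, rfl⟩ := Finset.card_eq_two.1 hs
  exact ⟨t, a, b, hab, rfl⟩

/-- A cocycle modulo two on the edges comes from signs of the vertices of the tetrahedra. -/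
theorem exists_isSignCocycle (φ : T.Edge → ZMod 2)
    (hφ : ∀ e₁ e₂ e₃, T.BoundsTriangle e₁ e₂ e₃ → φ e₁ + φ e₂ + φ e₃ = 0) :
    ∃ χ g, T.IsSignCocycle χ g ∧ ∀ t a b (h : a ≠ b), χ t a = χ t b → φ (T.edge t a b h) = 0 := by
  classical
  -- A potential for `φ` on the tetrahedron, based at vertex `0`; the triangles through that vertex
  -- give `hf`.
  let f : Fin n → Fin 4 → ZMod 2 := fun t a => if h : (0 : Fin 4) = a then 0 else φ (T.edge t 0 a h)
  have hzmod : ∀ x y z : ZMod 2, x + y + z = 0 → z = x + y := by decide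
  have hf (t : Fin n) (a b : Fin 4) (hab : a ≠ b) : φ (T.edge t a b hab) = f t a + f t b := by
    by_cases ha : (0 : Fin 4) = a
    · subst ha
      simp [f, hab]
    · by_cases hb : (0 : Fin 4) = b
      · subst hb
        simp [f, ha, edge_comm t hab]
      · simp only [f, dif_neg ha, dif_neg hb]
        exact hzmod _ _ _ (hφ _ _ _ ⟨t, 0, a, b, ha, hb, hab, rfl, rfl, rfl⟩)
  let s : ZMod 2 → SignType := fun x => if x = 0 then 1 else -1
  have hs0 : ∀ x, s x ≠ 0 := by decide
  have hsmul : ∀ x y, s (x + y) = s x * s y := by decide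
  have hsinj : ∀ x y, s x = s y → x + y = 0 := by decide
  -- A vertex of face `i` at which the sign of the gluing is read off. By `edge_adj` every other
  -- vertex of the face gives the same sign.
  let k : Fin 4 → Fin 4 := fun i => if i = 0 then 1 else 0
  have hk : ∀ i, i ≠ k i := by decide
  refine ⟨fun t a => s (f t a), fun t i => s (f (T.adj t i) (T.perm t i (k i)) + f t (k i)),
    ⟨fun t a => hs0 _, fun t i => hs0 _, ?_⟩, ?_⟩
  · intro t i j hj
    rw [← hsmul]
    congr 1
    by_cases hjk : j = k i
    · subst hjk
      rw [add_assoc, CharTwo.add_self_eq_zero, add_zero]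
    · have h1 := congrArg φ (edge_adj t hjk hj.symm (hk i))
      rw [hf, hf] at h1
      generalize f (T.adj t i) (T.perm t i j) = x at *
      generalize f (T.adj t i) (T.perm t i (k i)) = y at *
      generalize f t j = z at *
      generalize f t (k i) = w at *
      clear * - h1
      revert x y z w
      decide
  · intro t a b h hχ
    rw [hf]
    exact hsinj _ _ hχ

/-- On a closed manifold of dimension at least three with vanishing first homology modulo two every
cocycle modulo two on the edges of a one-vertex triangulation vanishes. -/
theorem cocycle_eq_zero {M : Type u} [TopologicalSpace M]
    [T2Space M] {E : Type*} [NormedAddCommGroup E]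
    [NormedSpace ℝ E] (hE : 2 < Module.rank ℝ E) [ChartedSpace E M]
    (hM : TrivialFirstHomologyModTwo M) (h : T.Realization ≃ₜ M) (hv : T.IsOneVertex)
    (φ : T.Edge → ZMod 2)
    (hφ : ∀ e₁ e₂ e₃, T.BoundsTriangle e₁ e₂ e₃ → φ e₁ + φ e₂ + φ e₃ = 0) (e : T.Edge) :
    φ e = 0 := by
  obtain ⟨χ, g, hχ, hφχ⟩ := exists_isSignCocycle φ hφ
  obtain ⟨t, a, b, hab, rfl⟩ := exists_edge_eq e
  exact hφχ t a b hab (hχ.vertex_eq hE hM h hv t a b)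

/-- The colours of an admissible colouring are integers. -/
theorem exists_int_eq_of_mem_Adm {M : Type u} [TopologicalSpace M]
    [T2Space M] {E : Type*} [NormedAddCommGroup E]
    [NormedSpace ℝ E] (hE : 2 < Module.rank ℝ E) [ChartedSpace E M]
    (hM : TrivialFirstHomologyModTwo M) (h : T.Realization ≃ₜ M) (hv : T.IsOneVertex) {r : ℕ}
    {θ : T.Edge → ℝ} (hθ : θ ∈ T.Adm r) (e : T.Edge) : ∃ z : ℤ, θ e = z := by
  choose m hm using fun e => (hθ.1 e)
  -- Here `m e` is twice the colour, and integral sums of colours mean even sums of the `m e`.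
  have := cocycle_eq_zero hE hM h hv (fun e => (m e : ZMod 2)) (fun e₁ e₂ e₃ hb => by
    obtain ⟨⟨z, hz⟩, -⟩ := hθ.2 e₁ e₂ e₃ hb
    rw [(hm e₁).2, (hm e₂).2, (hm e₃).2] at hz
    have hz' : ((m e₁ + m e₂ + m e₃ : ℕ) : ℤ) = 2 * z := by
      have : ((m e₁ + m e₂ + m e₃ : ℕ) : ℝ) = 2 * z := by push_cast; linarith
      exact_mod_cast this
    have := congrArg (Int.cast (R := ZMod 2)) hz'
    push_cast at this
    rw [this]
    have h2 : (2 : ZMod 2) = 0 := rfl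
    rw [h2, zero_mul]) e
  obtain ⟨k, hk⟩ := (ZMod.natCast_eq_zero_iff _ _).1 this
  refine ⟨k, ?_⟩
  rw [(hm e).2, hk]
  push_cast
  ring

end GenTriangulation

/-! ### Quasi-polynomials -/

/-- The quasi-polynomials, in terms of one polynomial for each residue class. -/
def IsResiduePolynomial (f : ℕ → ℝ) : Prop :=
  ∃ p : ℕ, 0 < p ∧ ∃ R : ℕ → ℝ[X], ∀ k, f k = (R (k % p)).eval (k : ℝ)

namespace IsResiduePolynomial

theorem isQuasiPolynomial {f : ℕ → ℝ} (hf : IsResiduePolynomial f) : IsQuasiPolynomial f := by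
  obtain ⟨p, hp, R, hR⟩ := hf
  refine ⟨(Finset.range p).sup fun r => (R r).natDegree, fun i k => (R (k % p)).coeff i,
    fun i => ⟨p, hp, fun k => by simp⟩, fun k => ?_⟩
  rw [hR, eval_eq_sum_range' (n := (Finset.range p).sup (fun r => (R r).natDegree) + 1)]
  · exact Finset.sum_congr rfl fun i _ => mul_comm _ _
  · exact Nat.lt_succ_of_le (Finset.le_sup (f := fun r => (R r).natDegree)
      (Finset.mem_range.2 (Nat.mod_lt k hp)))

/-- On a residue class, a polynomial in the quotient `q = (k - r) / p` is a polynomial in `k`. -/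
theorem of_residues {f : ℕ → ℝ} {p : ℕ} (hp : 0 < p)
    (h : ∀ r < p, ∃ Q : ℝ[X], ∀ q : ℕ, f (p * q + r) = Q.eval (q : ℝ)) : IsResiduePolynomial f := by
  choose! Q hQ using h
  refine ⟨p, hp, fun r => (Q r).comp (C (p : ℝ)⁻¹ * (X - C (r : ℝ))), fun k => ?_⟩
  have hp' : (p : ℝ) ≠ 0 := by exact_mod_cast hp.ne'
  have h1 := hQ (k % p) (Nat.mod_lt k hp) (k / p)
  rw [Nat.div_add_mod] at h1
  have h2 : (k : ℝ) = p * (k / p : ℕ) + (k % p : ℕ) := by exact_mod_cast (Nat.div_add_mod k p).symm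
  rw [h1, eval_comp]
  congr 1
  simp only [eval_mul, eval_C, eval_sub, eval_X]
  rw [eq_inv_mul_iff_mul_eq₀ hp', eq_sub_iff_add_eq]
  exact h2.symm

/-- The free factor `m` allows several functions to be brought to a common period. -/
theorem exists_residues {f : ℕ → ℝ} (hf : IsResiduePolynomial f) :
    ∃ p : ℕ, 0 < p ∧ ∀ m : ℕ, 0 < m → ∀ r, ∃ Q : ℝ[X], ∀ q : ℕ,
      f (p * m * q + r) = Q.eval (q : ℝ) := by
  obtain ⟨p, hp, R, hR⟩ := hf
  refine ⟨p, hp, fun m _ r => ⟨(R (r % p)).comp (C ((p * m : ℕ) : ℝ) * X + C (r : ℝ)), fun q => ?_⟩⟩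
  rw [hR, mul_assoc, Nat.mul_add_mod]
  simp [mul_assoc]

theorem const (c : ℝ) : IsResiduePolynomial fun _ => c :=
  ⟨1, one_pos, fun _ => C c, fun k => by simp⟩

theorem add {f g : ℕ → ℝ} (hf : IsResiduePolynomial f) (hg : IsResiduePolynomial g) :
    IsResiduePolynomial fun k => f k + g k := by
  obtain ⟨p, hp, hf⟩ := hf.exists_residues
  obtain ⟨p', hp', hg⟩ := hg.exists_residues
  refine of_residues (Nat.mul_pos hp hp') fun r _ => ?_
  obtain ⟨P, hP⟩ := hf p' hp' r
  obtain ⟨Q, hQ⟩ := hg p hp r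
  refine ⟨P + Q, fun q => ?_⟩
  rw [eval_add, ← hP, ← hQ, mul_comm p' p]

theorem const_mul (c : ℝ) {f : ℕ → ℝ} (hf : IsResiduePolynomial f) :
    IsResiduePolynomial fun k => c * f k := by
  obtain ⟨p, hp, R, hR⟩ := hf
  exact ⟨p, hp, fun r => C c * R r, fun k => by simp [hR]⟩

theorem sum {α : Type*} (s : Finset α) {f : α → ℕ → ℝ} (hf : ∀ i ∈ s, IsResiduePolynomial (f i)) :
    IsResiduePolynomial fun k => ∑ i ∈ s, f i k := by
  classical
  induction s using Finset.induction_on with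
  | empty => simpa using const 0
  | insert a s ha ih =>
    simp only [Finset.sum_insert ha]
    exact (hf a (by simp)).add (ih fun i hi => hf i (by simp [hi]))

theorem comp_mul {f : ℕ → ℝ} (hf : IsResiduePolynomial f) (B : ℕ) :
    IsResiduePolynomial fun k => f (B * k) := by
  obtain ⟨p, hp, R, hR⟩ := hf
  refine ⟨p, hp, fun r => (R (B * r % p)).comp (C (B : ℝ) * X), fun k => ?_⟩
  change f (B * k) = _
  rw [hR]
  simp [Nat.mul_mod]

theorem comp_succ {f : ℕ → ℝ} (hf : IsResiduePolynomial f) :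
    IsResiduePolynomial fun k => f (k + 1) := by
  obtain ⟨p, hp, R, hR⟩ := hf
  refine ⟨p, hp, fun r => (R ((r + 1) % p)).comp (X + 1), fun k => ?_⟩
  change f (k + 1) = _
  rw [hR]
  simp

theorem select {p : ℕ} (hp : 0 < p) {f : ℕ → ℕ → ℝ} (hf : ∀ r, IsResiduePolynomial (f r)) :
    IsResiduePolynomial fun k => f (k % p) k := by
  choose m hm hf using fun r => (hf r).exists_residues
  let P := ∏ r ∈ Finset.range p, m r
  have hP : 0 < P := Finset.prod_pos fun r _ => hm r
  refine of_residues (Nat.mul_pos hp hP) fun r _ => ?_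
  have hdvd : m (r % p) ∣ P :=
    Finset.dvd_prod_of_mem m (Finset.mem_range.2 (Nat.mod_lt r hp))
  obtain ⟨c, hc⟩ := hdvd
  obtain ⟨Q, hQ⟩ := hf (r % p) (p * c) (Nat.mul_pos hp (Nat.pos_of_ne_zero fun h => by
    rw [h, mul_zero] at hc; exact hP.ne' hc)) r
  refine ⟨Q, fun q => ?_⟩
  rw [← hQ]
  congr 1
  · rw [mul_assoc, Nat.mul_add_mod]
  · rw [hc]; ring

/-- Faulhaber's formula, applied to each monomial. -/
theorem exists_eval_sum_range (Q : ℝ[X]) :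
    ∃ S : ℝ[X], ∀ q : ℕ, ∑ i ∈ Finset.range q, Q.eval (i : ℝ) = S.eval (q : ℝ) := by
  induction Q using Polynomial.induction_on' with
  | add P Q hP hQ =>
    obtain ⟨S, hS⟩ := hP
    obtain ⟨S', hS'⟩ := hQ
    exact ⟨S + S', fun q => by simp [Finset.sum_add_distrib, hS, hS']⟩
  | monomial d a =>
    refine ⟨C (a / (d + 1)) * ((Polynomial.bernoulli (d + 1)).map (algebraMap ℚ ℝ) -
      C ((_root_.bernoulli (d + 1) : ℚ) : ℝ)), fun q => ?_⟩
    have h := congrArg (fun x : ℚ => (x : ℝ)) (Polynomial.sum_range_pow_eq_bernoulli_sub q d)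
    push_cast at h
    have hd : (d + 1 : ℝ) ≠ 0 := by positivity
    simp only [eval_monomial, ← Finset.mul_sum, eval_mul, eval_C, eval_sub]
    rw [div_mul_eq_mul_div, eq_div_iff hd, mul_assoc, mul_comm _ (d + 1 : ℝ), h]
    congr 2
    rw [eval_map]
    exact (eval₂_at_natCast (algebraMap ℚ ℝ) q).symm

/-- Differences are summed over whole periods, separately for each residue of the summation index.
Each of these `p` sums runs over values of one polynomial. -/
theorem of_sub {F f : ℕ → ℝ} (hf : IsResiduePolynomial f) (h : ∀ k, F (k + 1) = F k + f k) :
    IsResiduePolynomial F := by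
  obtain ⟨p, hp, hf⟩ := hf.exists_residues
  refine of_residues hp fun r _ => ?_
  choose Q hQ using fun j : ℕ => hf 1 one_pos (r + j)
  choose S hS using fun j => exists_eval_sum_range (Q j)
  have hstep : ∀ k m, F (k + m) = F k + ∑ j ∈ Finset.range m, f (k + j) := by
    intro k m
    induction m with
    | zero => simp
    | succ m ih => rw [← add_assoc, h, ih, Finset.sum_range_succ, add_assoc]
  refine ⟨C (F r) + ∑ j ∈ Finset.range p, S j, fun q => ?_⟩
  rw [eval_add, eval_C, eval_finsetSum, ← Finset.sum_congr rfl fun j _ => hS j q]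
  induction q with
  | zero => simp
  | succ q ih =>
    have : p * (q + 1) + r = p * q + r + p := by ring
    rw [this, hstep, ih, add_assoc]
    congr 1
    rw [← Finset.sum_add_distrib]
    refine Finset.sum_congr rfl fun j _ => ?_
    rw [Finset.sum_range_succ, ← hQ]
    congr 2
    ring

end IsResiduePolynomial

/-! ### Lattice points in dilates of rational polytopes -/

section LatticePoints

variable {ι κ : Type*} [Fintype ι]

/-- The integral points of a residue class modulo `N` in the `k`-fold dilate of a polyhedron that is
defined by linear inequalities, of which those in `T` are required to be equalities. -/
def latticeSolutions (a : κ → ι → ℤ) (b : κ → ℤ) (T : Finset κ) (N : ℕ) (c : ι → ℤ) (k : ℕ) :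
    Set (ι → ℤ) :=
  {x | (∀ i, (N : ℤ) ∣ x i - c i) ∧ (∀ j, a j ⬝ᵥ x ≤ k * b j) ∧ ∀ j ∈ T, a j ⬝ᵥ x = k * b j}

/-- The polyhedron defined by linear inequalities is bounded. -/
def IsBoundedSystem (a : κ → ι → ℤ) (b : κ → ℤ) : Prop :=
  ∃ C : ℕ, ∀ (k : ℕ) (x : ι → ℤ), (∀ j, a j ⬝ᵥ x ≤ k * b j) → ∀ i, |x i| ≤ C * k

namespace IsBoundedSystem

variable {a : κ → ι → ℤ} {b : κ → ℤ}

theorem finite (h : IsBoundedSystem a b) (T : Finset κ) (N : ℕ) (c : ι → ℤ) (k : ℕ) :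
    (latticeSolutions a b T N c k).Finite := by
  classical
  obtain ⟨C, hC⟩ := h
  refine (Set.finite_Icc (fun _ : ι => -((C * k : ℕ) : ℤ)) (fun _ => ((C * k : ℕ) : ℤ))).subset ?_
  intro x hx
  have := hC k x hx.2.1
  push_cast
  exact ⟨fun i => (abs_le.1 (this i)).1, fun i => (abs_le.1 (this i)).2⟩

theorem smul (h : IsBoundedSystem a b) {B : ℕ} (hB : 0 < B) :
    IsBoundedSystem (fun j => (B : ℤ) • a j) b := by
  obtain ⟨C, hC⟩ := h
  refine ⟨C, fun k x hx i => ?_⟩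
  have h1 := hC k ((B : ℤ) • x) (fun j => by
    have := hx j
    rwa [smul_dotProduct, ← dotProduct_smul] at this) i
  rw [Pi.smul_apply, smul_eq_mul, abs_mul, Nat.abs_cast] at h1
  have h2 : (1 : ℤ) ≤ B := by exact_mod_cast hB
  nlinarith [abs_nonneg (x i)]

theorem translate (h : IsBoundedSystem a b) (D : ℕ) (u : ι → ℤ) :
    IsBoundedSystem a (fun j => D * b j - a j ⬝ᵥ u) := by
  obtain ⟨C, hC⟩ := h
  refine ⟨C * D + ∑ i, (u i).natAbs, fun k x hx i => ?_⟩
  have h1 := hC (k * D) (x + (k : ℤ) • u) (fun j => by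
    have := hx j
    rw [dotProduct_add, dotProduct_smul, smul_eq_mul]
    push_cast
    linarith) i
  have h2 : ((u i).natAbs : ℤ) ≤ ((∑ i, (u i).natAbs : ℕ) : ℤ) := by
    exact_mod_cast Finset.single_le_sum (f := fun i => (u i).natAbs) (fun _ _ => Nat.zero_le _)
      (Finset.mem_univ i)
  rw [Int.natCast_natAbs] at h2
  have h3 : |x i| ≤ |(x + (k : ℤ) • u) i| + k * |u i| := by
    have := abs_sub (x i + k * u i) (k * u i)
    rw [add_sub_cancel_right, abs_mul, Nat.abs_cast] at this
    simpa using this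
  have h4 : (k : ℤ) * |u i| ≤ k * ((∑ i, (u i).natAbs : ℕ) : ℤ) :=
    mul_le_mul_of_nonneg_left h2 (Int.natCast_nonneg k)
  push_cast at h1 h4 ⊢
  linarith

end IsBoundedSystem

theorem mem_latticeSolutions_union {a : κ → ι → ℤ} {b : κ → ℤ} {T J : Finset κ} [DecidableEq κ]
    {N : ℕ} {c : ι → ℤ} {k : ℕ} {x : ι → ℤ} : x ∈ latticeSolutions a b (T ∪ J) N c k ↔
      x ∈ latticeSolutions a b T N c k ∧ ∀ j ∈ J, a j ⬝ᵥ x = k * b j := by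
  simp only [latticeSolutions, Set.mem_ofPred_eq, Finset.mem_union]
  constructor
  · rintro ⟨h1, h2, h3⟩
    exact ⟨⟨h1, h2, fun j hj => h3 j (Or.inl hj)⟩, fun j hj => h3 j (Or.inr hj)⟩
  · rintro ⟨⟨h1, h2, h3⟩, h4⟩
    exact ⟨h1, h2, fun j hj => hj.elim (h3 j) (h4 j)⟩

/-- The substitution `x ↦ D x - k u` moves `u / D` to the origin. The price is a congruence modulo
`D * N`, whose residue depends only on `k` modulo `D * N`. -/
theorem ncard_latticeSolutions_translate (a : κ → ι → ℤ) (b : κ → ℤ) (T : Finset κ) (N : ℕ)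
    (c : ι → ℤ) {D : ℕ} (hD : 0 < D) (u : ι → ℤ) (k : ℕ) :
    (latticeSolutions a b T N c k).ncard =
      (latticeSolutions a (fun j => D * b j - a j ⬝ᵥ u) T (D * N)
        (fun i => D * c i - (k % (D * N) : ℕ) * u i) k).ncard := by
  have hD' : (0 : ℤ) < D := by exact_mod_cast hD
  let φ : (ι → ℤ) → ι → ℤ := fun x => (D : ℤ) • x - (k : ℤ) • u
  have hφ : Function.Injective φ := by
    intro x y hxy
    have h1 : (D : ℤ) • x = (D : ℤ) • y := sub_left_injective hxy
    exact smul_right_injective _ hD'.ne' h1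
  rw [← Set.ncard_image_of_injective _ hφ]
  congr 1
  have hdot (j : κ) (x : ι → ℤ) : a j ⬝ᵥ φ x = D * (a j ⬝ᵥ x) - k * (a j ⬝ᵥ u) := by
    simp only [φ, dotProduct_sub, dotProduct_smul, smul_eq_mul]
  have hk : ((D * N : ℕ) : ℤ) ∣ (k : ℤ) - (k % (D * N) : ℕ) := by
    rw [Int.natCast_mod]
    exact Int.dvd_self_sub_emod
  have hres (x : ι → ℤ) (i : ι) : ((D * N : ℕ) : ℤ) ∣ φ x i - (D * c i - (k % (D * N) : ℕ) * u i) ↔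
      (N : ℤ) ∣ x i - c i := by
    have e : φ x i - (D * c i - (k % (D * N) : ℕ) * u i) =
        D * (x i - c i) - ((k : ℤ) - (k % (D * N) : ℕ)) * u i := by
      simp only [φ, Pi.sub_apply, Pi.smul_apply, smul_eq_mul]
      ring
    rw [e, dvd_sub_left (Dvd.dvd.mul_right hk _)]
    push_cast
    exact mul_dvd_mul_iff_left hD'.ne'
  have hmem (x : ι → ℤ) : φ x ∈ latticeSolutions a (fun j => D * b j - a j ⬝ᵥ u) T (D * N)
        (fun i => D * c i - (k % (D * N) : ℕ) * u i) k ↔ x ∈ latticeSolutions a b T N c k := by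
    have e (j : κ) : (k : ℤ) * (D * b j - a j ⬝ᵥ u) = D * (k * b j) - k * (a j ⬝ᵥ u) := by ring
    simp only [latticeSolutions, Set.mem_ofPred_eq, hres, hdot, e, sub_le_sub_iff_right,
      mul_le_mul_iff_right₀ hD', sub_left_inj, mul_right_inj' hD'.ne']
  ext y
  constructor
  · rintro ⟨x, hx, rfl⟩
    exact (hmem x).2 hx
  · intro hy
    have hdvd (i : ι) : (D : ℤ) ∣ y i + k * u i := by
      have h1 : (D : ℤ) ∣ ((D * N : ℕ) : ℤ) := by push_cast; exact dvd_mul_right _ _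
      have h2 := (h1.trans (hy.1 i))
      have h3 := h1.trans hk
      have e : y i + k * u i = (y i - (D * c i - (k % (D * N) : ℕ) * u i)) + D * c i +
          ((k : ℤ) - (k % (D * N) : ℕ)) * u i := by ring
      rw [e]
      exact (h2.add (dvd_mul_right _ _)).add (h3.mul_right _)
    choose x hx using hdvd
    have hxy : φ x = y := by
      ext i
      simp only [φ, Pi.sub_apply, Pi.smul_apply, smul_eq_mul, ← hx]
      ring
    exact ⟨x, (hmem x).1 (hxy ▸ hy), hxy⟩

variable [Fintype κ]

/-- The number of lattice points in a polytope that contains the origin, if those in its faces that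
do not contain the origin are known. -/
theorem IsBoundedSystem.isResiduePolynomial_of_nonneg {a : κ → ι → ℤ} {b : κ → ℤ}
    (h : IsBoundedSystem a b) {T : Finset κ} {N : ℕ} (c : ι → ℤ) (hb : ∀ j, 0 ≤ b j)
    (hbT : ∀ j ∈ T, b j = 0)
    (hface : ∀ (a' : κ → ι → ℤ) (T' : Finset κ), IsBoundedSystem a' b → T ⊂ T' →
      ∃ f, IsResiduePolynomial f ∧
        ∀ k : ℕ, 0 < k → ((latticeSolutions a' b T' N c k).ncard : ℝ) = f k) :
    IsResiduePolynomial fun k => ((latticeSolutions a b T N c k).ncard : ℝ) := by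
  classical
  let P := Finset.univ.filter fun j => 0 < b j
  have hbP (j) (hj : j ∉ P) : b j = 0 := by
    have := hb j
    simp only [P, Finset.mem_filter, Finset.mem_univ, true_and] at hj
    omega
  -- After multiplying each `a j` by `B`, every inequality with `b j > 0` reads `d * (a j ⬝ᵥ x) ≤ m`
  -- with an integer `d`. The original count is recovered at `m = B * k`.
  obtain ⟨B, hB, hBdvd⟩ : ∃ B : ℕ, 0 < B ∧ ∀ j ∈ P, b j ∣ B := by
    refine ⟨∏ j ∈ P, (b j).natAbs, Finset.prod_pos fun j hj => ?_, fun j hj => ?_⟩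
    · simp only [P, Finset.mem_filter] at hj
      omega
    · rw [← Int.natAbs_dvd, Int.natCast_dvd_natCast]
      exact Finset.dvd_prod_of_mem (fun j => (b j).natAbs) hj
  have hB' : (0 : ℤ) < B := by exact_mod_cast hB
  let a' : κ → ι → ℤ := fun j => (B : ℤ) • a j
  have ha' (j : κ) (x : ι → ℤ) : a' j ⬝ᵥ x = B * (a j ⬝ᵥ x) := by
    rw [smul_dotProduct, smul_eq_mul]
  have h' : IsBoundedSystem a' b := h.smul hB
  have hscale (k : ℕ) : latticeSolutions a b T N c k = latticeSolutions a' b T N c (B * k) := by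
    ext x
    have e1 (j : κ) : ((B * k : ℕ) : ℤ) * b j = B * (k * b j) := by push_cast; ring
    simp only [latticeSolutions, Set.mem_ofPred_eq, ha', e1, mul_le_mul_iff_right₀ hB',
      mul_right_inj' hB'.ne']
  let F : ℕ → ℝ := fun m => ((latticeSolutions a' b T N c m).ncard : ℝ)
  suffices hF : IsResiduePolynomial F by
    simp only [hscale]
    exact hF.comp_mul B
  have hPT (j) (hj : j ∈ P) : j ∉ T := by
    intro hjT
    simp only [P, Finset.mem_filter] at hj
    exact hj.2.ne' (hbT j hjT)
  have hg (J : Finset κ) : ∃ f, IsResiduePolynomial f ∧ (J ⊆ P → J.Nonempty → ∀ k : ℕ, 0 < k →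
      ((latticeSolutions a' b (T ∪ J) N c k).ncard : ℝ) = f k) := by
    by_cases hJ : J ⊆ P ∧ J.Nonempty
    · obtain ⟨hJP, j, hj⟩ := hJ
      obtain ⟨f, hf, hfk⟩ := hface a' (T ∪ J) h' (Finset.ssubset_iff_of_subset
        Finset.subset_union_left |>.2 ⟨j, Finset.mem_union_right _ hj, hPT j (hJP hj)⟩)
      exact ⟨f, hf, fun _ _ => hfk⟩
    · exact ⟨_, IsResiduePolynomial.const 0, fun h1 h2 => absurd ⟨h1, h2⟩ hJ⟩
  choose g hgr hg using hg
  let S : ℕ → Finset κ → Finset (ι → ℤ) := fun m J => (h'.finite (T ∪ J) N c m).toFinset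
  have hS {m J x} : x ∈ S m J ↔ x ∈ latticeSolutions a' b T N c m ∧
      ∀ j ∈ J, a' j ⬝ᵥ x = m * b j := by
    rw [Set.Finite.mem_toFinset, mem_latticeSolutions_union]
  have hScard (m J) : (latticeSolutions a' b (T ∪ J) N c m).ncard = (S m J).card :=
    Set.ncard_eq_toFinset_card _ (h'.finite (T ∪ J) N c m)
  -- By integrality, a point of the dilate `m + 1` that attains none of the bounds with `b j > 0`
  -- already lies in the dilate `m`. Constraints with `b j = 0` do not depend on the dilate.
  have hstep (m : ℕ) : S (m + 1) ∅ = S m ∅ ∪ P.biUnion fun j => S (m + 1) {j} := by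
    ext x
    simp only [Finset.mem_union, Finset.mem_biUnion, hS, Finset.notMem_empty, false_implies,
      implies_true, and_true, Finset.mem_singleton, forall_eq]
    constructor
    · rintro hx
      by_cases hex : ∃ j ∈ P, a' j ⬝ᵥ x = ((m + 1 : ℕ) : ℤ) * b j
      · obtain ⟨j, hj, hjx⟩ := hex
        exact Or.inr ⟨j, hj, hx, hjx⟩
      · push Not at hex
        refine Or.inl ⟨hx.1, fun j => ?_, fun j hj => ?_⟩
        · by_cases hj : j ∈ P
          · have h1 := lt_of_le_of_ne (hx.2.1 j) (hex j hj)
            obtain ⟨d, hd⟩ := hBdvd j hj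
            have hbj : 0 < b j := by
              simp only [P, Finset.mem_filter] at hj
              exact hj.2
            rw [ha', hd] at h1 ⊢
            have h2 : d * (a j ⬝ᵥ x) < (m + 1 : ℕ) := by
              refine lt_of_mul_lt_mul_left ?_ hbj.le
              linarith
            have h3 : d * (a j ⬝ᵥ x) ≤ m := by push_cast at h2; omega
            nlinarith
          · have := hx.2.1 j
            rw [hbP j hj, mul_zero] at this ⊢
            exact this
        · have := hx.2.2 j hj
          rw [hbT j hj, mul_zero] at this ⊢
          exact this
    · rintro (hx | ⟨j, hj, hx, -⟩)
      · refine ⟨hx.1, fun j => (hx.2.1 j).trans ?_, fun j hj => ?_⟩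
        · have := hb j
          push_cast
          linarith
        · rw [hx.2.2 j hj, hbT j hj, mul_zero, mul_zero]
      · exact hx
  have hdisj (m : ℕ) : Disjoint (S m ∅) (P.biUnion fun j => S (m + 1) {j}) := by
    rw [Finset.disjoint_left]
    intro x hx hx'
    obtain ⟨j, hj, hx'⟩ := Finset.mem_biUnion.1 hx'
    rw [hS] at hx hx'
    have h1 := hx.1.2.1 j
    have h2 := hx'.2 j (Finset.mem_singleton_self j)
    simp only [P, Finset.mem_filter] at hj
    push_cast at h2
    linarith [hj.2]
  -- The new points form a union of faces, counted by inclusion-exclusion. Faces enter only at `k +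
  -- 1`, so their counts are needed only for positive dilates.
  refine IsResiduePolynomial.of_sub (f := fun k => ∑ J ∈ P.powerset.filter (·.Nonempty),
    (-1) ^ (J.card + 1) * g J (k + 1))
    (IsResiduePolynomial.sum _ fun J _ => ((hgr J).comp_succ).const_mul _) fun m => ?_
  have hF (m : ℕ) : F m = ((S m ∅).card : ℝ) := by
    rw [← hScard, Finset.union_empty]
  rw [hF, hF, hstep, Finset.card_union_of_disjoint (hdisj m)]
  push_cast
  congr 1
  have hie := congrArg (fun z : ℤ => (z : ℝ))
    (Finset.inclusion_exclusion_card_biUnion P fun j => S (m + 1) {j})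
  push_cast at hie
  rw [hie, ← Finset.sum_coe_sort (P.powerset.filter (·.Nonempty))]
  refine Finset.sum_congr rfl fun J _ => ?_
  obtain ⟨J, hJ⟩ := J
  rw [Finset.mem_filter, Finset.mem_powerset] at hJ
  rw [← hg J hJ.1 hJ.2 (m + 1) m.succ_pos, hScard]
  congr 3
  ext x
  simp only [Finset.mem_inf', hS]
  constructor
  · intro hx
    obtain ⟨j, hj⟩ := hJ.2
    exact ⟨(hx j hj).1, fun j hj => (hx j hj).2 j (Finset.mem_singleton_self j)⟩
  · rintro ⟨h1, h2⟩ j hj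
    exact ⟨h1, fun j' hj' => by rw [Finset.mem_singleton.1 hj']; exact h2 j hj⟩

/-- The number of lattice points in the positive dilates of a rational polytope. -/
theorem IsBoundedSystem.exists_isResiduePolynomial {a : κ → ι → ℤ} {b : κ → ℤ}
    (h : IsBoundedSystem a b) (T : Finset κ) {N : ℕ} (hN : 0 < N) (c : ι → ℤ) :
    ∃ f, IsResiduePolynomial f ∧
      ∀ k : ℕ, 0 < k → ((latticeSolutions a b T N c k).ncard : ℝ) = f k := by
  classical
  induction hn : Tᶜ.card using Nat.strong_induction_on generalizing a b T N c with
  | _ s ih =>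
    -- A solution `u` in some dilate `D` makes the translated right hand sides nonnegative, and zero
    -- on `T`.
    by_cases hex : ∃ D : ℕ, 0 < D ∧ (latticeSolutions a b T N c D).Nonempty
    · obtain ⟨D, hD, u, hu⟩ := hex
      have hDN : 0 < D * N := Nat.mul_pos hD hN
      refine ⟨_, IsResiduePolynomial.select hDN (f := fun r k =>
        ((latticeSolutions a (fun j => D * b j - a j ⬝ᵥ u) T (D * N)
          (fun i => D * c i - (r : ℕ) * u i) k).ncard : ℝ)) fun r => ?_, fun k _ => ?_⟩
      · refine (h.translate D u).isResiduePolynomial_of_nonneg _ (fun j => ?_) (fun j hj => ?_) ?_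
        · linarith [hu.2.1 j]
        · linarith [hu.2.2 j hj]
        · intro a' T' h' hT'
          refine ih T'ᶜ.card ?_ h' T' hDN _ rfl
          rw [← hn]
          exact Finset.card_lt_card (Finset.compl_ssubset_compl.2 hT')
      · rw [ncard_latticeSolutions_translate a b T N c hD u k]
    -- The dilate `0` may still contain the origin, so the zero function is right only for `0 < k`.
    · push Not at hex
      refine ⟨_, IsResiduePolynomial.const 0, fun k hk => ?_⟩
      simp [hex k hk]

/-- Ehrhart's theorem for a rational polytope that contains the origin. -/
theorem IsBoundedSystem.isResiduePolynomial_ncard {a : κ → ι → ℤ} {b : κ → ℤ}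
    (h : IsBoundedSystem a b) (hb : ∀ j, 0 ≤ b j) : IsResiduePolynomial fun k : ℕ =>
      (({x : ι → ℤ | ∀ j, a j ⬝ᵥ x ≤ k * b j}.ncard : ℕ) : ℝ) := by
  have := h.isResiduePolynomial_of_nonneg (T := ∅) (N := 1) 0 hb (by simp)
    fun a' T' h' _ => h'.exists_isResiduePolynomial T' one_pos 0
  simpa [latticeSolutions] using this

end LatticePoints

/-! ### The admissibility polytope -/

namespace GenTriangulation

variable {n : ℕ} (T : GenTriangulation n)

instance : Finite T.Edge := inferInstanceAs (Finite (Quot _))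

/-- For `k > 0` the inequalities are rescaled. For `k = 0` both sides say `z = 0`, as the polytope
is nonempty and `0 ≤ 2 z ≤ 0`. -/
theorem mem_dilateLatticePoints_admissibilityPolytope {k : ℕ} {z : T.Edge → ℤ} :
    z ∈ dilateLatticePoints T.admissibilityPolytope k ↔ (∀ e, 0 ≤ z e ∧ 2 * z e ≤ k) ∧
      ∀ e₁ e₂ e₃, T.BoundsTriangle e₁ e₂ e₃ →
        (z e₁ ≤ z e₂ + z e₃ ∧ z e₂ ≤ z e₁ + z e₃ ∧ z e₃ ≤ z e₁ + z e₂) ∧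
        z e₁ + z e₂ + z e₃ ≤ k := by
  rcases Nat.eq_zero_or_pos k with rfl | hk
  · have h0 : (0 : T.Edge → ℝ) ∈ T.admissibilityPolytope := by
      simp [admissibilityPolytope]
    have h1 : z ∈ dilateLatticePoints T.admissibilityPolytope 0 ↔ z = 0 := by
      simp only [dilateLatticePoints, Set.mem_ofPred_eq, Nat.cast_zero,
        Set.zero_smul_set ⟨0, h0⟩, Set.mem_zero, funext_iff, Pi.zero_apply, Int.cast_eq_zero]
    rw [h1]
    constructor
    · rintro rfl
      simp
    · rintro ⟨h2, -⟩
      ext e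
      have := h2 e
      simp only [Pi.zero_apply]
      omega
  · have hk' : (0 : ℝ) < k := by exact_mod_cast hk
    have hdiv (x y : ℝ) : (k : ℝ)⁻¹ * x ≤ (k : ℝ)⁻¹ * y ↔ x ≤ y :=
      mul_le_mul_iff_right₀ (inv_pos.2 hk')
    have hone : (1 : ℝ) = (k : ℝ)⁻¹ * k := (inv_mul_cancel₀ hk'.ne').symm
    have hle (x : ℝ) : (k : ℝ)⁻¹ * x ≤ 1 ↔ x ≤ k := by
      conv_lhs => rw [hone]
      exact hdiv x k
    have hhalf (x : ℝ) : (k : ℝ)⁻¹ * x ≤ 1 / 2 ↔ 2 * x ≤ k := by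
      rw [← hle, le_div_iff₀ two_pos, mul_assoc, mul_comm x]
    have hnonneg (x : ℝ) : 0 ≤ (k : ℝ)⁻¹ * x ↔ 0 ≤ x := by
      have := hdiv 0 x
      rwa [mul_zero] at this
    simp only [dilateLatticePoints, Set.mem_ofPred_eq, Set.mem_smul_set_iff_inv_smul_mem₀ hk'.ne',
      admissibilityPolytope, Pi.smul_apply, smul_eq_mul, ← mul_add, hdiv, hle, hhalf, hnonneg]
    norm_cast

/-- The coefficients of the inequalities that define the admissibility polytope. -/
def polytopeCoeff [DecidableEq T.Edge] :
    T.Edge ⊕ T.Edge ⊕ {p : T.Edge × T.Edge × T.Edge // T.BoundsTriangle p.1 p.2.1 p.2.2} × Fin 4 →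
      T.Edge → ℤ
  | .inl e => Pi.single e (-1)
  | .inr (.inl e) => Pi.single e 2
  | .inr (.inr (p, i)) => Pi.single p.1.1 (![1, -1, -1, 1] i) +
      Pi.single p.1.2.1 (![-1, 1, -1, 1] i) + Pi.single p.1.2.2 (![-1, -1, 1, 1] i)

/-- The right hand sides of the inequalities that define the admissibility polytope. -/
def polytopeBound :
    T.Edge ⊕ T.Edge ⊕ {p : T.Edge × T.Edge × T.Edge // T.BoundsTriangle p.1 p.2.1 p.2.2} × Fin 4 → ℤ
  | .inl _ => 0
  | .inr (.inl _) => 1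
  | .inr (.inr (_, i)) => ![0, 0, 0, 1] i

theorem dilateLatticePoints_eq_setOf [DecidableEq T.Edge] [Fintype T.Edge] (k : ℕ) :
    dilateLatticePoints T.admissibilityPolytope k =
      {z | ∀ j, T.polytopeCoeff j ⬝ᵥ z ≤ k * T.polytopeBound j} := by
  ext z
  rw [mem_dilateLatticePoints_admissibilityPolytope]
  constructor
  · rintro ⟨h1, h2⟩ (e | e | ⟨⟨⟨e₁, e₂, e₃⟩, hp⟩, i⟩)
    · simpa [polytopeCoeff, polytopeBound] using (h1 e).1
    · simpa [polytopeCoeff, polytopeBound] using (h1 e).2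
    · obtain ⟨⟨h3, h4, h5⟩, h6⟩ := h2 e₁ e₂ e₃ hp
      fin_cases i <;> simp [polytopeCoeff, polytopeBound, add_dotProduct] <;> linarith
  · intro h
    refine ⟨fun e => ⟨?_, ?_⟩, fun e₁ e₂ e₃ hp => ?_⟩
    · simpa [polytopeCoeff, polytopeBound] using h (.inl e)
    · simpa [polytopeCoeff, polytopeBound] using h (.inr (.inl e))
    · have h' (i : Fin 4) := h (.inr (.inr (⟨(e₁, e₂, e₃), hp⟩, i)))
      have h0 := h' 0
      have h1 := h' 1
      have h2 := h' 2
      have h3 := h' 3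
      simp [polytopeCoeff, polytopeBound, add_dotProduct] at h0 h1 h2 h3
      refine ⟨⟨?_, ?_, ?_⟩, ?_⟩ <;> linarith

theorem isBoundedSystem_polytope [DecidableEq T.Edge] [Fintype T.Edge] :
    IsBoundedSystem T.polytopeCoeff T.polytopeBound := by
  refine ⟨1, fun k x hx e => ?_⟩
  have h1 := hx (.inl e)
  have h2 := hx (.inr (.inl e))
  simp only [polytopeCoeff, polytopeBound, single_dotProduct] at h1 h2
  rw [abs_le]
  constructor <;> push_cast <;> linarith

theorem polytopeBound_nonneg (j) : 0 ≤ T.polytopeBound j := by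
  rcases j with e | e | ⟨p, i⟩
  · exact le_rfl
  · exact zero_le_one
  · fin_cases i <;> simp [polytopeBound]

/-- The number of lattice points in the dilates of the admissibility polytope. -/
theorem isEhrhartQuasiPolynomial_ncard :
    IsEhrhartQuasiPolynomial T.admissibilityPolytope
      fun k => ((dilateLatticePoints T.admissibilityPolytope k).ncard : ℝ) := by
  classical
  have := Fintype.ofFinite T.Edge
  have := Fintype.ofFinite {p : T.Edge × T.Edge × T.Edge // T.BoundsTriangle p.1 p.2.1 p.2.2}
  refine ⟨?_, fun k => ⟨?_, rfl⟩⟩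
  · simp only [dilateLatticePoints_eq_setOf]
    exact (T.isBoundedSystem_polytope.isResiduePolynomial_ncard
      T.polytopeBound_nonneg).isQuasiPolynomial
  · rw [dilateLatticePoints_eq_setOf]
    refine (T.isBoundedSystem_polytope.finite ∅ 1 0 k).subset fun z hz => ?_
    exact ⟨fun i => by simp, hz, by simp⟩

variable {T}

/-- For integral colours the sum condition is automatic, and the colour `z = m / 2` has `m = 2 z`,
so `m + 2 ≤ r` becomes `2 z ≤ r - 2`. -/
theorem mem_Adm_intCast_iff {r : ℕ} (hr : 2 ≤ r) {z : T.Edge → ℤ} :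
    (fun e => (z e : ℝ)) ∈ T.Adm r ↔ z ∈ dilateLatticePoints T.admissibilityPolytope (r - 2) := by
  rw [mem_dilateLatticePoints_admissibilityPolytope]
  have hr' : ((r - 2 : ℕ) : ℤ) = (r : ℤ) - 2 := by omega
  rw [hr']
  refine and_congr (forall_congr' fun e => ?_) (forall₄_congr fun e₁ e₂ e₃ _ => ?_)
  · constructor
    · rintro ⟨m, hm, h⟩
      have h' : 2 * z e = m := by
        have : (2 : ℝ) * z e = m := by linarith
        exact_mod_cast this
      omega
    · rintro ⟨h1, h2⟩
      obtain ⟨m, hm⟩ := Int.eq_ofNat_of_zero_le h1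
      refine ⟨2 * m, by omega, ?_⟩
      simp only [hm]
      push_cast
      ring
  · rw [and_iff_right ⟨z e₁ + z e₂ + z e₃, by push_cast; rfl⟩]
    dsimp only
    norm_cast

end GenTriangulation

/-! ### The bijection and the count -/

theorem mainTheorem1 {M : Type u} [TopologicalSpace M] [T2Space M] [CompactSpace M]
    [ChartedSpace (EuclideanSpace ℝ (Fin 3)) M]
    (hM : TrivialFirstHomologyModTwo M)
    {n : ℕ} (T : GenTriangulation n) (hT : Nonempty (T.Realization ≃ₜ M))
    (hv : T.IsOneVertex) :
    (∀ r : ℕ, 3 ≤ r →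
      ∃ Φ : T.Adm r ≃ dilateLatticePoints T.admissibilityPolytope (r - 2),
        ∀ (θ : T.Adm r) (e : T.Edge), ((Φ θ).1 e : ℝ) = θ.1 e) ∧
    ∃ L : ℕ → ℝ, IsEhrhartQuasiPolynomial T.admissibilityPolytope L ∧
      ∀ r : ℕ, 3 ≤ r → (T.Adm r).Finite ∧ ((T.Adm r).ncard : ℝ) = L (r - 2) := by
  obtain ⟨h⟩ := hT
  have hE : 2 < Module.rank ℝ (EuclideanSpace ℝ (Fin 3)) := by
    rw [← Module.finrank_eq_rank, finrank_euclideanSpace_fin]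
    norm_num
  have hΦ (r : ℕ) (hr : 3 ≤ r) :
      ∃ Φ : T.Adm r ≃ dilateLatticePoints T.admissibilityPolytope (r - 2),
        ∀ (θ : T.Adm r) (e : T.Edge), ((Φ θ).1 e : ℝ) = θ.1 e := by
    have hr2 : 2 ≤ r := by omega
    choose z hz using fun (θ : T.Adm r) (e : T.Edge) =>
      GenTriangulation.exists_int_eq_of_mem_Adm hE hM h hv θ.2 e
    have hz' (θ : T.Adm r) : (fun e => (z θ e : ℝ)) = θ.1 := funext fun e => (hz θ e).symm
    refine ⟨⟨fun θ => ⟨z θ, (GenTriangulation.mem_Adm_intCast_iff hr2).1 ((hz' θ).symm ▸ θ.2)⟩,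
      fun y => ⟨fun e => (y.1 e : ℝ), (GenTriangulation.mem_Adm_intCast_iff hr2).2 y.2⟩,
      fun θ => Subtype.ext (hz' θ), fun y => Subtype.ext (funext fun e => ?_)⟩,
      fun θ e => (hz θ e).symm⟩
    exact Int.cast_injective (hz ⟨fun e => (y.1 e : ℝ), _⟩ e).symm
  refine ⟨hΦ, _, T.isEhrhartQuasiPolynomial_ncard, fun r hr => ?_⟩
  obtain ⟨Φ, -⟩ := hΦ r hr
  have hfin := (T.isEhrhartQuasiPolynomial_ncard.2 (r - 2)).1
  refine ⟨?_, ?_⟩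
  · have := hfin.to_subtype
    exact Set.finite_coe_iff.1 (Finite.of_equiv _ Φ.symm)
  · exact congrArg _ (Nat.card_congr Φ)
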